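/- Let $K=SO(3)$ act on $\mathcal N=\mathbb R^3_x\times\mathbb R^3_y$ by $k(x,y)=(kx,ky)$. Let $K'\subset K$ be the stabiliser of the plane $\{y_3=0\}$ of $\mathbb R^3$. Each $k\in K'$ maps $(0,0,1)$ to $(0,0,\epsilon_k)$ with $\epsilon_k=\pm1$, and $K'$ acts on $\mathcal N'=\mathbb R^3_x\times\mathbb R_t$ by $k(x,t)=(kx,\epsilon_k t)$. Functions are complex valued. Let $C^\infty(\mathcal N)^K$ and $\mathcal S(\mathcal N)^K$ denote the $K$-invariant smooth and Schwartz functions on $\mathcal N$, and similarly for $(\mathcal N',K')$. For $f$ on $\mathcal N$ let $\mathrm{Rest}\,f(x,t)=f(x,(0,0,t))$. Let $\mathcal N_o=\{(x,y)\in\mathcal N: y\neq0\}$; for $h\in C^\infty(\mathcal N')^{K'}$ define $\mathrm{Radial}(h)$ on $\mathcal N_o$ by $$\mathrm{Radial}(h)(x,y)=h(k^{-1}x,t),\qquad\text{where } y=k(0,0,t)\text{ with } k\in K,\ t\in\mathbb R$$ (this does not depend on the choice of $k$ and $t$). For $M\in\mathbb N$, $f\in C^\infty(\mathcal N)^K$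 and $g\in C^\infty(\mathcal N')^{K'}$ let $$P_M^{(f)}(x,y)=\sum_{|j|=M}\frac1{j!}\,\partial_y^jf(x,0)\,y^j,\qquad Q_M^{(g)}(x,t)=\frac1{M!}\,\partial_t^Mg(x,0)\,t^M .$$ Say that $g$ satisfies Property (R) if for every $M\in\mathbb N$ the function $\mathrm{Radial}(Q_M^{(g)})$ extends to a smooth function on $\mathcal N$ which is a homogeneous polynomial in $y$ of degree $M$ with smooth coefficients in $x$. **Proposition.** Let $g\in C^\infty(\mathcal N')^{K'}$. Then $g=\mathrm{Rest}\,f$ for some $f\in C^\infty(\mathcal N)^K$ if and only if $g$ satisfies Property (R). In this case $\mathrm{Radial}(g)$ extends to a function $f\in C^\infty(\mathcal N)^K$ whose restriction to $\mathcal N'$ is $g$, and $Q_M^{(g)}=\mathrm{Rest}\,[P_M^{(f)}]$ for every $M\in\mathbb N$. If moreover $g\in\mathcal S(\mathcal N')^{K'}$, then this extension $f$ of $\mathrm{Radial}(g)$ belongs to $\mathcal S(\mathcal N)^K$. -/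

import Mathlib

open scoped ContDiff SchwartzMap

namespace RadialExtension

/-- Euclidean three-space. -/
abbrev E3 : Type := EuclideanSpace ℝ (Fin 3)

/-- The space `𝒩 = ℝ³ × ℝ³`, with points `(x, y)`. -/
abbrev Space : Type := E3 × E3

/-- The space `𝒩' = ℝ³ × ℝ`, with points `(x, t)`. -/
abbrev SpacePrime : Type := E3 × ℝ

/-- The group `K = SO(3)`. -/
abbrev K : Type := Matrix.specialOrthogonalGroup (Fin 3) ℝ

/-- The action of `SO(3)` on `ℝ³`. -/
noncomputable def rot (k : K) (v : E3) : E3 :=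
  WithLp.toLp 2 (Matrix.mulVec (k : Matrix (Fin 3) (Fin 3) ℝ) (WithLp.ofLp v))

theorem rot_one (v : E3) : rot 1 v = v := by
  simp [rot]

theorem rot_mul (k l : K) (v : E3) : rot (k * l) v = rot k (rot l v) := by
  simp [rot, Matrix.mulVec_mulVec]

theorem rot_inv_rot (k : K) (v : E3) : rot k⁻¹ (rot k v) = v := by
  rw [← rot_mul, inv_mul_cancel, rot_one]

theorem rot_rot_inv (k : K) (v : E3) : rot k (rot k⁻¹ v) = v := by
  rw [← rot_mul, mul_inv_cancel, rot_one]

/-- The simultaneous action of `SO(3)` on both factors of `𝒩`. -/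
noncomputable def act (k : K) (p : Space) : Space := (rot k p.1, rot k p.2)

/-- The vertical vector `(0, 0, t)`. -/
noncomputable def vert (t : ℝ) : E3 := !₂[0, 0, t]

/-- The horizontal plane `{y | y₃ = 0}` of `ℝ³`. -/
def plane : Set E3 := {v | v 2 = 0}

/-- The group `K'`, the stabiliser of the horizontal plane in `SO(3)`. -/
def KPrime : Subgroup K where
  carrier := {k | rot k '' plane = plane}
  mul_mem' := by
    intro a b (ha : rot a '' plane = plane) (hb : rot b '' plane = plane)
    have h : rot (a * b) = rot a ∘ rot b := funext (rot_mul a b)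
    change rot (a * b) '' plane = plane
    rw [h, Set.image_comp, hb, ha]
  one_mem' := by
    have h : rot 1 = id := funext rot_one
    change rot 1 '' plane = plane
    rw [h, Set.image_id]
  inv_mem' := by
    intro a (ha : rot a '' plane = plane)
    have h : rot a⁻¹ ∘ rot a = id := funext (rot_inv_rot a)
    change rot a⁻¹ '' plane = plane
    conv_lhs => rw [← ha]
    rw [← Set.image_comp, h, Set.image_id]

/-- The action of `K'` on `𝒩'`, where `𝒩' = 𝒩 / ({0} × plane)` through
`(x, y) ↦ (x, y₃)`: the class of `(x, (0, 0, t))` goes to the class of its image. -/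
noncomputable def actPrime (k : KPrime) (p : SpacePrime) : SpacePrime :=
  (rot k p.1, rot k (vert p.2) 2)

/-- `C^∞(𝒩)^K`: complex valued smooth `K`-invariant functions on `𝒩`. -/
def smoothInv : Set (Space → ℂ) :=
  {f | ContDiff ℝ ∞ f ∧ ∀ (k : K) (p : Space), f (act k p) = f p}

/-- `C^∞(𝒩')^{K'}`: complex valued smooth `K'`-invariant functions on `𝒩'`. -/
def smoothInvPrime : Set (SpacePrime → ℂ) :=
  {g | ContDiff ℝ ∞ g ∧ ∀ (k : KPrime) (p : SpacePrime), g (actPrime k p) = g p}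

/-- The function `f` is a Schwartz function. -/
def IsSchwartz {E : Type*} [NormedAddCommGroup E] [NormedSpace ℝ E] (f : E → ℂ) : Prop :=
  ∃ φ : 𝓢(E, ℂ), ⇑φ = f

/-- Restriction from `𝒩` to `𝒩'`, where `𝒩'` sits in `𝒩` as the points `(x, (0, 0, t))`. -/
noncomputable def rest (f : Space → ℂ) : SpacePrime → ℂ := fun p => f (p.1, vert p.2)

/-- The open set `𝒩_o` of the points `(x, y)` with `y ≠ 0`. -/
def regularPart : Set Space := {p | p.2 ≠ 0}

/-- The radialisation: `Radial(h)(x, y) = h(k⁻¹ x, t)`, where `y = k (0, 0, t)` for some `k ∈ K`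
and `t`. It is meaningful on `𝒩_o`, for `K'`-invariant `h`; see `exists_rot_vert` and
`radial_eq`. -/
noncomputable def radial (h : SpacePrime → ℂ) (p : Space) : ℂ :=
  let q : K × ℝ := Classical.epsilon fun q : K × ℝ => p.2 = rot q.1 (vert q.2)
  h (rot q.1⁻¹ p.1, q.2)

/-- The monomial `y^j`. -/
noncomputable def monom (j : Fin 3 → ℕ) (y : E3) : ℂ := ∏ i, ((y i : ℝ) : ℂ) ^ j i

/-- The multi-indices `j ∈ ℕ³` of length `|j| = M`. -/
def multiIndices (M : ℕ) : Finset (Fin 3 → ℕ) := Finset.piAntidiag Finset.univ M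

/-- The partial derivative `∂_{y_i} F`. -/
noncomputable def pderiv (i : Fin 3) (F : E3 → ℂ) : E3 → ℂ :=
  fun y => fderiv ℝ F y (EuclideanSpace.single i 1)

/-- The derivative `∂^j F = ∂_{y_1}^{j_1} ∂_{y_2}^{j_2} ∂_{y_3}^{j_3} F`. -/
noncomputable def mderiv (j : Fin 3 → ℕ) (F : E3 → ℂ) : E3 → ℂ :=
  (pderiv 0)^[j 0] ((pderiv 1)^[j 1] ((pderiv 2)^[j 2] F))

/-- `P_M^{(f)}(x, y) = ∑_{|j| = M} (1 / j!) ∂_y^j f(x, 0) y^j`. -/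
noncomputable def taylorP (M : ℕ) (f : Space → ℂ) : Space → ℂ := fun p =>
  ∑ j ∈ multiIndices M,
    (1 / ((∏ i, (j i).factorial : ℕ) : ℂ)) * mderiv j (fun y => f (p.1, y)) 0 * monom j p.2

/-- `Q_M^{(g)}(x, t) = (1 / M!) ∂_t^M g(x, 0) t^M`. -/
noncomputable def taylorQ (M : ℕ) (g : SpacePrime → ℂ) : SpacePrime → ℂ := fun p =>
  (1 / (M.factorial : ℂ)) * iteratedDeriv M (fun t : ℝ => g (p.1, t)) 0 * (p.2 : ℂ) ^ M

/-- `P` is a homogeneous polynomial in `y` of degree `M`, with smooth coefficients in `x`. -/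
def IsHomogeneousInY (M : ℕ) (P : Space → ℂ) : Prop :=
  ∃ c : (Fin 3 → ℕ) → E3 → ℂ, (∀ j ∈ multiIndices M, ContDiff ℝ ∞ (c j)) ∧
    ∀ x y : E3, P (x, y) = ∑ j ∈ multiIndices M, c j x * monom j y

/-- Property (R): for every `M`, the function `Radial(Q_M^{(g)})`, defined on `𝒩_o`, extends to a
smooth function on `𝒩` that is a homogeneous polynomial in `y` of degree `M`, with smooth
coefficients in `x`. -/
def PropertyR (g : SpacePrime → ℂ) : Prop :=
  ∀ M : ℕ, ∃ P : Space → ℂ, ContDiff ℝ ∞ P ∧ IsHomogeneousInY M P ∧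
    ∀ p ∈ regularPart, P p = radial (taylorQ M g) p

/-- Every `y ∈ ℝ³` has the form `k (0, 0, t)`. -/
theorem exists_rot_vert (y : E3) : ∃ (k : K) (t : ℝ), y = rot k (vert t) := by
  obtain ⟨r, hr0, hr⟩ : ∃ r : ℝ, 0 ≤ r ∧ r ^ 2 = y 0 ^ 2 + y 1 ^ 2 + y 2 ^ 2 :=
    ⟨√(y 0 ^ 2 + y 1 ^ 2 + y 2 ^ 2), Real.sqrt_nonneg _, Real.sq_sqrt (by positivity)⟩
  by_cases hd : r * (r + y 2) = 0
  · have h01 : y 0 ^ 2 + y 1 ^ 2 = 0 := by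
      rcases mul_eq_zero.1 hd with h | h
      · rw [h] at hr
        nlinarith [sq_nonneg (y 0), sq_nonneg (y 1), sq_nonneg (y 2)]
      · have : r = - y 2 := by linarith
        rw [this] at hr
        linarith
    have h0 : y 0 = 0 := by nlinarith [sq_nonneg (y 0), sq_nonneg (y 1)]
    have h1 : y 1 = 0 := by nlinarith [sq_nonneg (y 0), sq_nonneg (y 1)]
    refine ⟨1, y 2, ?_⟩
    rw [rot_one]
    ext i
    fin_cases i <;> simp [vert, h0, h1]
  · have hr1 : r ≠ 0 := left_ne_zero_of_mul hd
    have hr2 : r + y 2 ≠ 0 := right_ne_zero_of_mul hd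
    generalize hd' : r * (r + y 2) = d at hd
    have e0 : y 0 ^ 2 + y 1 ^ 2 + (y 2 + r) ^ 2 = 2 * d := by rw [← hd']; linear_combination -hr
    let w : Fin 3 → ℝ := ![y 0, y 1, y 2 + r]
    have hw : dotProduct w w = 2 * d := by
      simp only [dotProduct, Fin.sum_univ_three, w]
      simp
      linear_combination e0
    let A : Matrix (Fin 3) (Fin 3) ℝ := d⁻¹ • Matrix.vecMulVec w w - 1
    have hA : A ∈ Matrix.specialOrthogonalGroup (Fin 3) ℝ := by
      rw [Matrix.mem_specialOrthogonalGroup_iff]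
      constructor
      · rw [Matrix.mem_orthogonalGroup_iff]
        have hT : A.transpose = A := by
          ext i j
          simp [A, Matrix.vecMulVec_apply, Matrix.one_apply, eq_comm, mul_comm]
        have hsq : Matrix.vecMulVec w w * Matrix.vecMulVec w w
            = (2 * d) • Matrix.vecMulVec w w := by
          rw [Matrix.vecMulVec_mul_vecMulVec, hw]
          ext i j
          simp [Matrix.vecMulVec_apply]
          ring
        rw [hT]
        simp only [A, sub_mul, mul_sub, smul_mul_assoc, mul_smul_comm, hsq, mul_one, one_mul,
          smul_smul]
        ext i j
        simp only [Matrix.sub_apply, Matrix.smul_apply, smul_eq_mul]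
        field_simp
        ring
      · rw [Matrix.det_fin_three]
        simp [A, w]
        field_simp
        linear_combination d ^ 2 * e0
    refine ⟨⟨A, hA⟩, r, ?_⟩
    have hcol : ∀ i, rot ⟨A, hA⟩ (vert r) i = A i 2 * r := by
      intro i
      simp only [rot, Matrix.mulVec, dotProduct, Fin.sum_univ_three, vert]
      simp
    ext i
    rw [hcol]
    simp only [A, Matrix.sub_apply, Matrix.smul_apply, Matrix.vecMulVec_apply, smul_eq_mul,
      Matrix.one_apply]
    rw [← hd']
    fin_cases i <;> simp [w] <;> field_simp <;> ring

theorem dotProduct_rot (k : K) (v w : E3) :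
    dotProduct (rot k v).ofLp (rot k w).ofLp = dotProduct v.ofLp w.ofLp := by
  have h : (k : Matrix (Fin 3) (Fin 3) ℝ).transpose * k = 1 :=
    (Matrix.mem_orthogonalGroup_iff' (Fin 3) ℝ).1
      (Matrix.mem_specialOrthogonalGroup_iff.1 k.2).1
  simp only [rot]
  rw [Matrix.dotProduct_mulVec, ← Matrix.mulVec_transpose, Matrix.mulVec_mulVec, h,
    Matrix.one_mulVec]

theorem rot_mem_plane {k : K} {s t : ℝ} (ht : t ≠ 0) (hk : rot k (vert s) = vert t)
    {v : E3} (hv : v ∈ plane) : rot k v ∈ plane := by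
  have h := dotProduct_rot k v (vert s)
  rw [hk] at h
  have hv' : v 2 = 0 := hv
  simp [dotProduct, Fin.sum_univ_three, vert, hv', ht] at h
  exact h

/-- The radialisation does not depend on the choice of `k` and `t`. -/
theorem radial_eq {h : SpacePrime → ℂ}
    (hh : ∀ (k : KPrime) (p : SpacePrime), h (actPrime k p) = h p)
    (x y : E3) (hy : y ≠ 0) (k : K) (t : ℝ) (hk : y = rot k (vert t)) :
    radial h (x, y) = h (rot k⁻¹ x, t) := by
  have hv0 : ∀ (l : K) (s : ℝ), y = rot l (vert s) → s ≠ 0 := by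
    rintro l s hl rfl
    apply hy
    rw [hl]
    have : (![0, 0, 0] : Fin 3 → ℝ) = 0 := by ext i; fin_cases i <;> rfl
    simp [rot, vert, this]
  have hq := Classical.epsilon_spec
    (p := fun q : K × ℝ => y = rot q.1 (vert q.2)) ⟨(k, t), hk⟩
  simp only [radial]
  generalize Classical.epsilon (fun q : K × ℝ => y = rot q.1 (vert q.2)) = q at hq ⊢
  obtain ⟨l, s⟩ := q
  have h1 : rot (k⁻¹ * l) (vert s) = vert t := by
    rw [rot_mul, ← hq, hk, rot_inv_rot]
  have h2 : rot (k⁻¹ * l)⁻¹ (vert t) = vert s := by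
    rw [← h1, rot_inv_rot]
  have hm : k⁻¹ * l ∈ KPrime := by
    change rot (k⁻¹ * l) '' plane = plane
    apply Set.Subset.antisymm
    · rintro _ ⟨v, hv, rfl⟩
      exact rot_mem_plane (hv0 k t hk) h1 hv
    · intro v hv
      exact ⟨_, rot_mem_plane (hv0 l s hq) h2 hv, rot_rot_inv _ _⟩
  have h3 := hh ⟨k⁻¹ * l, hm⟩ (rot l⁻¹ x, s)
  rw [← h3]
  simp only [actPrime, h1, rot_mul, rot_rot_inv]
  simp [vert]

end RadialExtension

/-! Away from y = 0 the radialisation is, up to a rotation, g composed with a smooth local section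
`straighten` of the orbit map, so only the behaviour at y = 0 is at stake. Dilating to |y| = 1 shows
that n derivatives of Radial(h) cost a factor |y|⁻ⁿ near y = 0, locally uniformly in x
(`norm_iteratedFDeriv_radial_le`). If h is flat of order M along t = 0, its derivatives of order at
most n are O(|y|^(M-n)), so those of order n of Radial(h) are O(|y|^(M-2n))
(`norm_iteratedFDeriv_radial_le_of_flat`).

Property (R) says that the Taylor terms of g create no singularity: Radial(g) is a sum of
polynomials in y, smooth everywhere, and of the radialised Taylor remainder. Once 2N + 2 terms are
removed, the remainder extends by zero to a C^N function (`contDiff_of_norm_iteratedFDeriv_le_sq`).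
The extension of Radial(g) does not depend on N, so it is smooth; K-invariance reaches y = 0 by
density.

Conversely, if g = Rest f, the part of degree M in y of the Taylor expansion of f is K-invariant and
restricts to Q_M, hence coincides with Radial(Q_M) off y = 0 (`propertyR_rest`).

When g is Schwartz, the derivative bound loses only polynomial factors for |y| ≥ 1. For |y| ≤ 1, the
coefficients of the polynomials are Schwartz, by interpolation between finitely many values of y,
and the flat estimate gives the decay in x of the remainder (`isSchwartz_extension`). -/

namespace RadialExtension

/-! ### Calculus near the subspace E × {0}: gluing and flatness. -/

section Calculus

variable {E V F G : Type} [NormedAddCommGroup E] [NormedSpace ℝ E]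
  [NormedAddCommGroup V] [NormedSpace ℝ V] [NormedAddCommGroup F] [NormedSpace ℝ F]
  [NormedAddCommGroup G] [NormedSpace ℝ G]

theorem norm_iteratedFDeriv_comp_clm_le {f : F → G} {U : Set F} (hU : IsOpen U)
    (hf : ContDiffOn ℝ ∞ f U) (L : E →L[ℝ] F) {x : E} (hx : L x ∈ U) (n : ℕ) :
    ‖iteratedFDeriv ℝ n (f ∘ L) x‖ ≤ ‖iteratedFDeriv ℝ n f (L x)‖ * ‖L‖ ^ n := by
  have hU' : IsOpen (L ⁻¹' U) := hU.preimage L.continuous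
  have h := L.iteratedFDerivWithin_comp_right hf hU.uniqueDiffOn hU'.uniqueDiffOn hx (i := n)
    (by exact_mod_cast le_top)
  rw [iteratedFDerivWithin_of_isOpen n hU' hx, iteratedFDerivWithin_of_isOpen n hU hx] at h
  rw [h]
  refine (ContinuousMultilinearMap.norm_compContinuousLinearMap_le _ _).trans ?_
  simp

/-- A function that vanishes on `E × {0}` and whose derivatives away from this subspace are
quadratically small near it is continuously differentiable. -/
theorem contDiff_of_norm_iteratedFDeriv_le_sq (N : ℕ) : ∀ {G : Type} [NormedAddCommGroup G]
    [NormedSpace ℝ G] {f : E × V → G}, (∀ x, f (x, 0) = 0) →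
    (∀ p : E × V, p.2 ≠ 0 → ContDiffAt ℝ ∞ f p) →
    (∀ n ≤ N, ∀ ρ : ℝ, ∃ C : ℝ, ∀ x y, ‖x‖ ≤ ρ → y ≠ 0 → ‖y‖ ≤ 1 →
      ‖iteratedFDeriv ℝ n f (x, y)‖ ≤ C * ‖y‖ ^ 2) →
    ContDiff ℝ N f := by
  -- Since |y| is at most the distance to (x, 0), the bound C|y|² is quadratic in that distance, so
  -- the derivative exists there and is zero.
  have key : ∀ {G : Type} [NormedAddCommGroup G]
      [NormedSpace ℝ G] {f : E × V → G}, (∀ x, f (x, 0) = 0) →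
      (∀ ρ : ℝ, ∃ C : ℝ, ∀ x y, ‖x‖ ≤ ρ → y ≠ 0 → ‖y‖ ≤ 1 →
        ‖iteratedFDeriv ℝ 0 f (x, y)‖ ≤ C * ‖y‖ ^ 2) →
      ∀ x, HasFDerivAt f (0 : E × V →L[ℝ] G) (x, 0) := by
    intro G _ _ f h0 hb x
    obtain ⟨C, hC⟩ := hb (‖x‖ + 1)
    refine Asymptotics.IsBigO.hasFDerivAt (n := 2) ?_ one_lt_two
    refine Asymptotics.IsBigO.of_bound (|C|) ?_
    filter_upwards [Metric.ball_mem_nhds (x, (0 : V)) one_pos] with z hz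
    obtain ⟨u, v⟩ := z
    rw [Metric.mem_ball, dist_eq_norm] at hz
    have h1 : ‖u - x‖ ≤ ‖(u, v) - (x, (0 : V))‖ := by
      simp
    have h2 : ‖v‖ ≤ ‖(u, v) - (x, (0 : V))‖ := by
      simp
    rw [norm_pow, norm_norm]
    by_cases hv : v = 0
    · subst hv
      rw [h0, norm_zero]
      positivity
    · have h3 := hC u v (by
        have := norm_add_le (u - x) x
        rw [sub_add_cancel] at this
        linarith) hv (by linarith)
      rw [norm_iteratedFDeriv_zero] at h3
      calc ‖f (u, v)‖ ≤ C * ‖v‖ ^ 2 := h3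
        _ ≤ |C| * ‖v‖ ^ 2 := by gcongr; exact le_abs_self C
        _ ≤ _ := by gcongr
  induction N with
  | zero =>
    intro G _ _ f h0 hs hb
    rw [Nat.cast_zero, contDiff_zero, continuous_iff_continuousAt]
    rintro ⟨x, y⟩
    by_cases hy : y = 0
    · subst hy
      exact (key h0 (hb 0 le_rfl) x).continuousAt
    · exact (hs (x, y) hy).continuousAt
  | succ N ih =>
    intro G _ _ f h0 hs hb
    have k := key h0 (hb 0 (Nat.zero_le _))
    rw [Nat.cast_succ, contDiff_succ_iff_fderiv]
    -- The derivative again vanishes on E × {0} and satisfies the same bounds with orders shifted by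
    -- one; it has another target space, hence the quantification over `G`.
    refine ⟨?_, by simp, ih (fun x => (k x).fderiv) ?_ ?_⟩
    · rintro ⟨x, y⟩
      by_cases hy : y = 0
      · subst hy
        exact (k x).differentiableAt
      · exact (hs (x, y) hy).differentiableAt (by simp)
    · intro p hp
      exact (hs p hp).fderiv_right (m := ∞) (by simp)
    · intro n hn ρ
      obtain ⟨C, hC⟩ := hb (n + 1) (by omega) ρ
      exact ⟨C, fun x y hx hy hy1 => by
        rw [norm_iteratedFDeriv_fderiv]; exact hC x y hx hy hy1⟩

/-- The derivative in the second variable. -/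
noncomputable def dt (h : E × ℝ → F) : E × ℝ → F := fun p => fderiv ℝ h p (0, 1)

theorem contDiff_dt {h : E × ℝ → F} (hh : ContDiff ℝ ∞ h) : ContDiff ℝ ∞ (dt h) :=
  (hh.fderiv_right (m := ∞) (by simp)).clm_apply contDiff_const

theorem contDiff_iterate_dt {h : E × ℝ → F} (hh : ContDiff ℝ ∞ h) (m : ℕ) :
    ContDiff ℝ ∞ (dt^[m] h) := by
  induction m generalizing h with
  | zero => exact hh
  | succ m ih => exact ih (contDiff_dt hh)

/-- Symmetry of the second derivative. -/
theorem dt_fderiv {h : E × ℝ → F} (hh : ContDiff ℝ ∞ h) :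
    dt (fderiv ℝ h) = fderiv ℝ (dt h) := by
  funext p
  refine ContinuousLinearMap.ext fun v => ?_
  have hd : DifferentiableAt ℝ (fderiv ℝ h) p :=
    (hh.fderiv_right (m := ∞) (by simp)).differentiable (by simp) p
  have hsymm := (hh.contDiffAt (x := p)).isSymmSndFDerivAt (n := ∞)
    (by rw [minSmoothness_of_isRCLikeNormedField]; exact WithTop.coe_le_coe.2 le_top)
  have : fderiv ℝ (dt h) p v = fderiv ℝ (fderiv ℝ h) p v (0, 1) := by
    unfold dt
    rw [fderiv_clm_apply hd (differentiableAt_const _)]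
    simp
  rw [this]
  exact hsymm.eq _ _

theorem iterate_dt_fderiv {h : E × ℝ → F} (hh : ContDiff ℝ ∞ h) (m : ℕ) :
    dt^[m] (fderiv ℝ h) = fderiv ℝ (dt^[m] h) := by
  induction m generalizing h with
  | zero => rfl
  | succ m ih =>
    rw [Function.iterate_succ_apply, dt_fderiv hh, ih (contDiff_dt hh), Function.iterate_succ_apply]

theorem hasDerivAt_dt {h : E × ℝ → F} (hh : ContDiff ℝ ∞ h) (x : E) (t : ℝ) :
    HasDerivAt (fun s => h (x, s)) (dt h (x, t)) t := by
  have h1 : HasFDerivAt h (fderiv ℝ h (x, t)) (x, t) :=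
    (hh.differentiable (by simp) (x, t)).hasFDerivAt
  exact h1.comp_hasDerivAt t ((hasDerivAt_const t x).prodMk (hasDerivAt_id t))

theorem iteratedDeriv_eq_iterate_dt {h : E × ℝ → F} (hh : ContDiff ℝ ∞ h) (m : ℕ) (x : E) :
    iteratedDeriv m (fun t => h (x, t)) = fun t => (dt^[m] h) (x, t) := by
  induction m generalizing h with
  | zero => simp
  | succ m ih =>
    rw [iteratedDeriv_succ', Function.iterate_succ_apply, ← ih (contDiff_dt hh)]
    congr 1
    funext t
    exact (hasDerivAt_dt hh x t).deriv

/-- If the derivatives of `h` in the second variable, of order less than `M`, vanish on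
`E × {0}`, so do all derivatives of order less than `M`. -/
theorem iteratedFDeriv_eq_zero_of_iterate_dt (i : ℕ) : ∀ {F : Type} [NormedAddCommGroup F]
    [NormedSpace ℝ F] {h : E × ℝ → F} (_ : ContDiff ℝ ∞ h) {M : ℕ}
    (_ : ∀ m < M, ∀ x, (dt^[m] h) (x, 0) = 0), i < M → ∀ x, iteratedFDeriv ℝ i h (x, 0) = 0 := by
  induction i with
  | zero =>
    intro F _ _ h hh M h0 hi x
    rw [← norm_eq_zero, norm_iteratedFDeriv_zero, norm_eq_zero]
    exact h0 0 hi x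
  | succ i ih =>
    intro F _ _ h hh M h0 hi x
    rw [← norm_eq_zero, ← norm_iteratedFDeriv_fderiv, norm_eq_zero]
    -- The full derivative of h is flat of order M - 1: along E one differentiates a function that
    -- is identically zero, and along ℝ one meets the next iterate of `dt`.
    refine ih (hh.fderiv_right (m := ∞) (by simp)) (M := M - 1) ?_ (by omega) x
    intro m hm x
    rw [iterate_dt_fderiv hh]
    have hs := contDiff_iterate_dt hh m
    have hd : HasFDerivAt (dt^[m] h) (fderiv ℝ (dt^[m] h) (x, 0)) (x, 0) :=
      (hs.differentiable (by simp) _).hasFDerivAt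
    have h1 : (fderiv ℝ (dt^[m] h) (x, 0)).comp (ContinuousLinearMap.inl ℝ E ℝ) = 0 := by
      have e1 : HasFDerivAt (fun u : E => (dt^[m] h) (u, 0))
          ((fderiv ℝ (dt^[m] h) (x, 0)).comp (ContinuousLinearMap.inl ℝ E ℝ)) x :=
        hd.comp x ((ContinuousLinearMap.inl ℝ E ℝ).hasFDerivAt (x := x))
      have e2 : (fun u : E => (dt^[m] h) (u, 0)) = fun _ => 0 := funext (h0 m (by omega))
      rw [e2] at e1
      exact e1.unique (hasFDerivAt_const _ _)
    have h2 : fderiv ℝ (dt^[m] h) (x, 0) (0, 1) = 0 := by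
      have := h0 (m + 1) (by omega) x
      rwa [Function.iterate_succ_apply'] at this
    refine ContinuousLinearMap.ext fun ⟨u, τ⟩ => ?_
    have e : ((u, τ) : E × ℝ) = ContinuousLinearMap.inl ℝ E ℝ u + τ • (0, 1) := by simp
    rw [e, map_add, map_smul, h2, smul_zero, add_zero]
    exact congrArg (fun L : E →L[ℝ] F => L u) h1

/-- A function that is flat of order `M` along `E × {0}` is controlled there by its derivatives of
order `M`. -/
theorem norm_iteratedFDeriv_le_of_flat {h : E × ℝ → F} (hh : ContDiff ℝ ∞ h) {M : ℕ}
    (h0 : ∀ m < M, ∀ x, (dt^[m] h) (x, 0) = 0) {x : E} {C : ℝ}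
    (hC : ∀ s : ℝ, ‖s‖ ≤ 1 → ‖iteratedFDeriv ℝ M h (x, s)‖ ≤ C) :
    ∀ j ≤ M, ∀ t : ℝ, ‖t‖ ≤ 1 → ‖iteratedFDeriv ℝ (M - j) h (x, t)‖ ≤ C * ‖t‖ ^ j := by
  intro j
  induction j with
  | zero => intro _ t ht; simpa using hC t ht
  | succ j ih =>
    intro hj t ht
    have hC0 : 0 ≤ C := (norm_nonneg _).trans (hC 0 (by simp))
    obtain ⟨i, hi⟩ : ∃ i, M = i + (j + 1) := ⟨M - (j + 1), by omega⟩
    have e1 : M - (j + 1) = i := by omega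
    have e2 : M - j = i + 1 := by omega
    rw [e1]
    rw [e2] at ih
    have hD : Differentiable ℝ (iteratedFDeriv ℝ i h) :=
      hh.differentiable_iteratedFDeriv (by exact_mod_cast WithTop.coe_lt_top i)
    have hder : ∀ s ∈ Set.uIcc 0 t, HasDerivWithinAt (fun s => iteratedFDeriv ℝ i h (x, s))
        (fderiv ℝ (iteratedFDeriv ℝ i h) (x, s) (0, 1)) (Set.uIcc 0 t) s := fun s _ =>
      ((hD (x, s)).hasFDerivAt.comp_hasDerivAt s
        ((hasDerivAt_const s x).prodMk (hasDerivAt_id s))).hasDerivWithinAt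
    have hbd : ∀ s ∈ Set.uIcc 0 t, ‖fderiv ℝ (iteratedFDeriv ℝ i h) (x, s) (0, 1)‖
        ≤ C * ‖t‖ ^ j := by
      intro s hs
      have hst : ‖s‖ ≤ ‖t‖ := by
        simpa using Set.abs_sub_left_of_mem_uIcc hs
      calc _ ≤ ‖fderiv ℝ (iteratedFDeriv ℝ i h) (x, s)‖ * ‖((0 : E), (1 : ℝ))‖ :=
            ContinuousLinearMap.le_opNorm _ _
        _ = ‖iteratedFDeriv ℝ (i + 1) h (x, s)‖ := by
            rw [norm_fderiv_iteratedFDeriv]; simp [Prod.norm_def]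
        _ ≤ C * ‖s‖ ^ j := ih (by omega) s (hst.trans ht)
        _ ≤ _ := by gcongr
    -- Mean value inequality from s = 0, where the derivative of order i vanishes: each lowering of
    -- the order gains a factor |t|.
    have := (convex_uIcc (0 : ℝ) t).norm_image_sub_le_of_norm_hasDerivWithin_le hder hbd
      Set.left_mem_uIcc Set.right_mem_uIcc
    rw [iteratedFDeriv_eq_zero_of_iterate_dt i hh h0 (by omega) x, sub_zero, sub_zero] at this
    rwa [pow_succ, ← mul_assoc]

end Calculus

/-! ### Rotations and invariance of the radialisation. -/

/-- The action of `SO(3)` on `ℝ³` by continuous linear maps. -/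
noncomputable def rotL (k : K) : E3 →L[ℝ] E3 :=
  Matrix.toEuclideanCLM (𝕜 := ℝ) (k : Matrix (Fin 3) (Fin 3) ℝ)

theorem rotL_apply (k : K) (v : E3) : rotL k v = rot k v := rfl

theorem norm_rot (k : K) (v : E3) : ‖rot k v‖ = ‖v‖ := by
  have h := dotProduct_rot k v v
  rw [EuclideanSpace.norm_eq, EuclideanSpace.norm_eq]
  congr 1
  simp only [dotProduct] at h
  simp only [Real.norm_eq_abs, sq_abs]
  simpa only [pow_two] using h

theorem rot_vert_two (k : K) (t : ℝ) :
    rot k (vert t) 2 = (k : Matrix (Fin 3) (Fin 3) ℝ) 2 2 * t := by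
  simp only [rot, Matrix.mulVec, dotProduct, Fin.sum_univ_three, vert]
  simp

theorem vert_zero : vert 0 = 0 := by
  ext i
  fin_cases i <;> simp [vert]

theorem vert_eq_smul (t : ℝ) : vert t = t • vert 1 := by
  ext i
  fin_cases i <;> simp [vert]

theorem norm_vert (t : ℝ) : ‖vert t‖ = |t| := by
  rw [EuclideanSpace.norm_eq, Fin.sum_univ_three]
  simp [vert, Real.sqrt_sq_eq_abs]

theorem vert_ne_zero {t : ℝ} (ht : t ≠ 0) : vert t ≠ 0 := by
  rw [← norm_ne_zero_iff, norm_vert]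
  exact abs_ne_zero.2 ht

theorem rot_zero (k : K) : rot k 0 = 0 := map_zero (rotL k)

theorem rot_ne_zero (k : K) {y : E3} (hy : y ≠ 0) : rot k y ≠ 0 := by
  rw [← norm_ne_zero_iff, norm_rot]
  exact norm_ne_zero_iff.2 hy

/-- The diagonal action of `SO(3)` by continuous linear maps. -/
noncomputable def actL (k : K) : Space →L[ℝ] Space := (rotL k).prodMap (rotL k)

theorem actL_apply (k : K) (p : Space) : actL k p = act k p := rfl

theorem radial_act {h : SpacePrime → ℂ}
    (hh : ∀ (k : KPrime) (p : SpacePrime), h (actPrime k p) = h p) (k : K) {p : Space}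
    (hp : p.2 ≠ 0) : radial h (act k p) = radial h p := by
  obtain ⟨x, y⟩ := p
  obtain ⟨l, t, hl⟩ := exists_rot_vert y
  rw [radial_eq hh x y hp l t hl, act,
    radial_eq hh _ _ (rot_ne_zero k hp) (k * l) t (by rw [rot_mul, ← hl]),
    mul_inv_rev, rot_mul, rot_inv_rot]

theorem radial_vert {h : SpacePrime → ℂ}
    (hh : ∀ (k : KPrime) (p : SpacePrime), h (actPrime k p) = h p) (x : E3) {t : ℝ} (ht : t ≠ 0) :
    radial h (x, vert t) = h (x, t) := by
  rw [radial_eq hh x _ (vert_ne_zero ht) 1 t (rot_one _).symm, inv_one, rot_one]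

/-- The half turn about the first axis. -/
noncomputable def halfTurn : K := ⟨Matrix.diagonal ![1, -1, -1], by
  rw [Matrix.mem_specialOrthogonalGroup_iff]
  constructor
  · rw [Matrix.mem_orthogonalGroup_iff, Matrix.diagonal_transpose, Matrix.diagonal_mul_diagonal,
      ← Matrix.diagonal_one]
    congr 1
    funext i
    fin_cases i <;> simp
  · rw [Matrix.det_diagonal, Fin.prod_univ_three]
    simp⟩

theorem rot_halfTurn_vert (t : ℝ) : rot halfTurn (vert t) = vert (-t) := by
  ext i
  fin_cases i <;> simp [rot, halfTurn, vert, Matrix.mulVec_diagonal]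

/-- A half turn about a horizontal axis reverses the vertical one, so t may be replaced by |t|. -/
theorem exists_rot_eq_vert_norm (y : E3) : ∃ k : K, rot k y = vert ‖y‖ := by
  obtain ⟨k, t, rfl⟩ := exists_rot_vert y
  rw [norm_rot, norm_vert]
  rcases le_total 0 t with ht | ht
  · exact ⟨k⁻¹, by rw [rot_inv_rot, abs_of_nonneg ht]⟩
  · exact ⟨halfTurn * k⁻¹, by rw [rot_mul, rot_inv_rot, rot_halfTurn_vert, abs_of_nonpos ht]⟩

/-! ### A smooth local section of the orbit map. -/

/-- The points `(x, y)` such that `y` is not on the closed negative vertical half axis. -/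
def slit : Set Space := {p | 0 < ‖p.2‖ + p.2 2}

theorem isOpen_slit : IsOpen slit :=
  isOpen_lt continuous_const (by fun_prop)

theorem snd_ne_zero_of_mem_slit {p : Space} (hp : p ∈ slit) : p.2 ≠ 0 := by
  intro h
  simp [slit, h] at hp

theorem mem_slit_vert (x : E3) {t : ℝ} (ht : 0 < t) : (x, vert t) ∈ slit := by
  change 0 < ‖vert t‖ + vert t 2
  rw [norm_vert, abs_of_pos ht]
  simpa [vert] using ht

/-- A smooth section of the quotient map `(x, y) ↦ K (x, y)` onto `𝒩'`, over the complement of the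
closed negative vertical half axis: `(x, y)` is rotated by the half turn about the bisector of `y`
and of the vertical axis. -/
noncomputable def straighten (p : Space) : SpacePrime :=
  (((‖p.2‖ * (‖p.2‖ + p.2 2))⁻¹ * inner ℝ (p.2 + ‖p.2‖ • vert 1) p.1) • (p.2 + ‖p.2‖ • vert 1)
    - p.1, ‖p.2‖)

/-- The half turn about the line of w = y + |y|e₃ exchanges y/|y| and e₃. Its matrix is d⁻¹wwᵀ - 1,
where d = |y|(|y| + y₃) ≠ 0 and |w|² = 2d. It is its own inverse, which yields the formula in
`straighten`. -/
theorem exists_rot_straighten (y : E3) (hy : 0 < ‖y‖ + y 2) :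
    ∃ k : K, y = rot k (vert ‖y‖) ∧ ∀ x, rot k⁻¹ x = (straighten (x, y)).1 := by
  obtain ⟨r, hr⟩ : ∃ r, r = ‖y‖ := ⟨_, rfl⟩
  have hr2 : r ^ 2 = y 0 ^ 2 + y 1 ^ 2 + y 2 ^ 2 := by
    rw [hr, EuclideanSpace.norm_sq_eq, Fin.sum_univ_three]
    simp
  rw [← hr] at hy
  have hy0 : r ≠ 0 := by
    rintro rfl
    have : y 2 = 0 := by nlinarith [sq_nonneg (y 0), sq_nonneg (y 1)]
    linarith
  have hd0 : r * (r + y 2) ≠ 0 := mul_ne_zero hy0 hy.ne'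
  obtain ⟨d, hd⟩ : ∃ d, d = r * (r + y 2) := ⟨_, rfl⟩
  rw [← hd] at hd0
  have e0 : y 0 ^ 2 + y 1 ^ 2 + (y 2 + r) ^ 2 = 2 * d := by rw [hd]; linear_combination -hr2
  let w : Fin 3 → ℝ := ![y 0, y 1, y 2 + r]
  have hw : dotProduct w w = 2 * d := by
    simp only [dotProduct, Fin.sum_univ_three, w]
    simp
    linear_combination e0
  let A : Matrix (Fin 3) (Fin 3) ℝ := d⁻¹ • Matrix.vecMulVec w w - 1
  have hT : A.transpose = A := by
    ext i j
    simp [A, Matrix.vecMulVec_apply, Matrix.one_apply, eq_comm, mul_comm]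
  have hAA : A * A = 1 := by
    have hsq : Matrix.vecMulVec w w * Matrix.vecMulVec w w
        = (2 * d) • Matrix.vecMulVec w w := by
      rw [Matrix.vecMulVec_mul_vecMulVec, hw]
      ext i j
      simp [Matrix.vecMulVec_apply]
      ring
    simp only [A, sub_mul, mul_sub, smul_mul_assoc, mul_smul_comm, hsq, mul_one, one_mul,
      smul_smul]
    ext i j
    simp only [Matrix.sub_apply, Matrix.smul_apply, smul_eq_mul]
    field_simp
    ring
  have hA : A ∈ Matrix.specialOrthogonalGroup (Fin 3) ℝ := by
    rw [Matrix.mem_specialOrthogonalGroup_iff]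
    constructor
    · rw [Matrix.mem_orthogonalGroup_iff, hT, hAA]
    · rw [Matrix.det_fin_three]
      simp [A, w]
      field_simp
      linear_combination d ^ 2 * e0
  let k : K := ⟨A, hA⟩
  have hkk : k⁻¹ = k := inv_eq_of_mul_eq_one_right (Subtype.ext hAA)
  refine ⟨k, ?_, ?_⟩
  · rw [← hr]
    have hcol : ∀ i, rot k (vert r) i = A i 2 * r := by
      intro i
      simp only [rot, Matrix.mulVec, dotProduct, Fin.sum_univ_three, vert, k]
      simp
    ext i
    rw [hcol]
    simp only [A, Matrix.sub_apply, Matrix.smul_apply, Matrix.vecMulVec_apply, smul_eq_mul,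
      Matrix.one_apply]
    rw [hd]
    fin_cases i <;> simp [w] <;> field_simp <;> ring
  · intro x
    rw [hkk]
    have hin : inner ℝ (y + r • vert 1) x = y 0 * x 0 + y 1 * x 1 + (y 2 + r) * x 2 := by
      rw [PiLp.inner_apply, Fin.sum_univ_three]
      simp [vert]
      ring
    simp only [straighten, ← hr, hin, ← hd]
    ext i
    have : rot k x i = A i 0 * x 0 + A i 1 * x 1 + A i 2 * x 2 := by
      simp only [rot, Matrix.mulVec, dotProduct, Fin.sum_univ_three, k]
    rw [this]
    simp only [A, Matrix.sub_apply, Matrix.smul_apply, Matrix.vecMulVec_apply, smul_eq_mul,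
      Matrix.one_apply]
    fin_cases i <;> simp [w, vert] <;> ring

theorem radial_eq_straighten {h : SpacePrime → ℂ}
    (hh : ∀ (k : KPrime) (p : SpacePrime), h (actPrime k p) = h p) {p : Space} (hp : p ∈ slit) :
    radial h p = h (straighten p) := by
  obtain ⟨x, y⟩ := p
  obtain ⟨k, hk, hx⟩ := exists_rot_straighten y hp
  rw [radial_eq hh x y (snd_ne_zero_of_mem_slit hp) k ‖y‖ hk, hx]
  rfl

theorem norm_straighten_fst {p : Space} (hp : p ∈ slit) : ‖(straighten p).1‖ = ‖p.1‖ := by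
  obtain ⟨x, y⟩ := p
  obtain ⟨k, hk, hx⟩ := exists_rot_straighten y hp
  rw [← hx, norm_rot]

theorem contDiffOn_straighten : ContDiffOn ℝ ∞ straighten slit := by
  intro p hp
  refine ContDiffAt.contDiffWithinAt ?_
  have h2 : ContDiffAt ℝ ∞ (fun p : Space => p.2) p := contDiffAt_snd
  have hn : ContDiffAt ℝ ∞ (fun p : Space => ‖p.2‖) p := h2.norm ℝ (snd_ne_zero_of_mem_slit hp)
  have hc : ContDiffAt ℝ ∞ (fun p : Space => p.2 2) p :=
    (EuclideanSpace.proj (𝕜 := ℝ) (2 : Fin 3)).contDiff.contDiffAt.comp p h2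
  have hw : ContDiffAt ℝ ∞ (fun p : Space => p.2 + ‖p.2‖ • vert 1) p :=
    h2.add (hn.smul contDiffAt_const)
  refine ContDiffAt.prodMk (((((hn.mul (hn.add hc)).inv ?_).mul (hw.inner ℝ contDiffAt_fst)).smul
    hw).sub contDiffAt_fst) hn
  exact mul_ne_zero (norm_ne_zero_iff.2 (snd_ne_zero_of_mem_slit hp)) (ne_of_gt hp)

/-- The first component is linear in x and homogeneous of degree 0 in y; the second is homogeneous
of degree 1 in y. Independent scalings of x and y thus reduce derivative bounds to |x| ≤ 1, |y| = 1.
-/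
theorem straighten_smul {s r : ℝ} (hr : 0 < r) (p : Space) :
    straighten (s • p.1, r • p.2) = (s • (straighten p).1, r • (straighten p).2) := by
  obtain ⟨x, y⟩ := p
  have hn : ‖r • y‖ = r * ‖y‖ := by rw [norm_smul, Real.norm_of_nonneg hr.le]
  simp only [straighten, hn, PiLp.smul_apply, smul_eq_mul, mul_smul, ← smul_add, ← mul_add,
    inner_smul_left, inner_smul_right, RCLike.conj_to_real, smul_sub]
  congr 2
  simp only [smul_smul]
  congr 1
  field_simp

theorem exists_norm_iteratedFDeriv_straighten_le (n : ℕ) : ∃ B : ℝ, 1 ≤ B ∧ ∀ i ≤ n, ∀ x : E3,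
    ‖x‖ ≤ 1 → ‖iteratedFDeriv ℝ i straighten (x, vert 1)‖ ≤ B := by
  have hc : IsCompact ((Metric.closedBall (0 : E3) 1) ×ˢ {vert 1}) :=
    (isCompact_closedBall _ _).prod isCompact_singleton
  have hsub : (Metric.closedBall (0 : E3) 1) ×ˢ {vert 1} ⊆ slit := by
    rintro ⟨x, y⟩ ⟨_, hy⟩
    obtain rfl : y = vert 1 := hy
    exact mem_slit_vert x one_pos
  have h : ∀ i : ℕ, ∃ B : ℝ, ∀ x : E3, ‖x‖ ≤ 1 →
      ‖iteratedFDeriv ℝ i straighten (x, vert 1)‖ ≤ B := by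
    intro i
    have hcont := (contDiffOn_straighten.continuousOn_iteratedFDerivWithin (m := i)
      (by exact_mod_cast le_top) isOpen_slit.uniqueDiffOn).mono hsub
    obtain ⟨B, hB⟩ := hc.exists_bound_of_continuousOn hcont
    refine ⟨B, fun x hx => ?_⟩
    rw [← iteratedFDerivWithin_of_isOpen i isOpen_slit (mem_slit_vert x one_pos)]
    exact hB _ ⟨by simpa using hx, rfl⟩
  choose B hB using h
  -- The summand 1 ensures B ≤ B^i for i ≥ 1, the form in which the estimate for compositions wants
  -- its bounds.
  refine ⟨1 + ∑ i ∈ Finset.range (n + 1), |B i|, ?_, fun i hi x hx => ?_⟩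
  · have : 0 ≤ ∑ i ∈ Finset.range (n + 1), |B i| := Finset.sum_nonneg fun _ _ => abs_nonneg _
    linarith
  · have h1 : |B i| ≤ ∑ i ∈ Finset.range (n + 1), |B i| :=
      Finset.single_le_sum (f := fun i => |B i|) (fun _ _ => abs_nonneg _)
        (Finset.mem_range.2 (by omega))
    linarith [hB i x hx, le_abs_self (B i)]

/-! ### Derivative bounds for the radialisation, by scaling. -/

/-- Multiplication of the two components by `s` and by `r`. -/
noncomputable def dilation (V : Type) [NormedAddCommGroup V] [NormedSpace ℝ V] (s r : ℝ) :
    E3 × V →L[ℝ] E3 × V :=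
  (s • ContinuousLinearMap.id ℝ E3).prodMap (r • ContinuousLinearMap.id ℝ V)

theorem dilation_apply {V : Type} [NormedAddCommGroup V] [NormedSpace ℝ V] (s r : ℝ)
    (p : E3 × V) : dilation V s r p = (s • p.1, r • p.2) := rfl

theorem norm_dilation_le {V : Type} [NormedAddCommGroup V] [NormedSpace ℝ V] {s r c : ℝ}
    (hs : |s| ≤ c) (hr : |r| ≤ c) : ‖dilation V s r‖ ≤ c := by
  have hc : 0 ≤ c := (abs_nonneg s).trans hs
  refine ContinuousLinearMap.opNorm_le_bound _ hc fun p => ?_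
  rw [dilation_apply, Prod.norm_def]
  refine max_le ?_ ?_
  · rw [norm_smul]
    exact mul_le_mul hs (norm_fst_le p) (norm_nonneg _) hc
  · rw [norm_smul]
    exact mul_le_mul hr (norm_snd_le p) (norm_nonneg _) hc

theorem norm_actL_le (k : K) : ‖actL k‖ ≤ 1 := by
  refine ContinuousLinearMap.opNorm_le_bound _ zero_le_one fun p => ?_
  rw [actL_apply, act, Prod.norm_def, norm_rot, norm_rot, one_mul, ← Prod.norm_def]

/-- Near `(x, y)`, a rotation and dilations identify the radialisation of `h` with
`h ∘ straighten`. -/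
theorem radial_eventuallyEq {h : SpacePrime → ℂ}
    (hh : ∀ (k : KPrime) (p : SpacePrime), h (actPrime k p) = h p) {s r : ℝ} (hs : 0 < s)
    (hr : 0 < r) (k : K) {z : Space} (hz : act k z ∈ slit) :
    radial h =ᶠ[nhds z]
      ((h ∘ dilation ℝ s r) ∘ straighten) ∘ (dilation E3 s⁻¹ r⁻¹ ∘L actL k) := by
  have ho : actL k ⁻¹' slit ∈ nhds z :=
    (isOpen_slit.preimage (actL k).continuous).mem_nhds hz
  filter_upwards [ho] with p hp
  have hp2 : p.2 ≠ 0 := by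
    intro h0
    refine snd_ne_zero_of_mem_slit hp ?_
    rw [actL_apply, act, h0, rot_zero]
  have hp' : act k p ∈ slit := hp
  rw [← radial_act hh k hp2, radial_eq_straighten hh hp']
  simp only [Function.comp_apply, ContinuousLinearMap.comp_apply, actL_apply, dilation_apply]
  rw [straighten_smul (inv_pos.2 hr), smul_inv_smul₀ hs.ne', smul_inv_smul₀ hr.ne']

theorem contDiffAt_radial {h : SpacePrime → ℂ} (hh : h ∈ smoothInvPrime) {p : Space}
    (hp : p.2 ≠ 0) : ContDiffAt ℝ ∞ (radial h) p := by
  obtain ⟨k, hk⟩ := exists_rot_eq_vert_norm p.2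
  have hs : act k p ∈ slit := by
    rw [act, hk]
    exact mem_slit_vert _ (norm_pos_iff.2 hp)
  have he := radial_eventuallyEq hh.2 one_pos one_pos k hs
  refine ContDiffAt.congr_of_eventuallyEq ?_ he
  refine ContDiffAt.comp p ?_ (ContinuousLinearMap.contDiff _).contDiffAt
  refine ContDiffAt.comp _ (hh.1.comp (ContinuousLinearMap.contDiff _)).contDiffAt ?_
  refine contDiffOn_straighten.contDiffAt (isOpen_slit.mem_nhds ?_)
  simpa [dilation_apply, actL_apply] using hs

/-- The derivatives of the radialisation of `h` at `(x, y)` are controlled by those of `h` at a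
point `(x', |y|)` with `|x'| = |x|`. -/
theorem norm_iteratedFDeriv_radial_le (n : ℕ) : ∃ B : ℝ, 0 ≤ B ∧ ∀ x y : E3, y ≠ 0 →
    ∃ x' : E3, ‖x'‖ = ‖x‖ ∧ ∀ h ∈ smoothInvPrime, ∀ C : ℝ,
      (∀ i ≤ n, ‖iteratedFDeriv ℝ i h (x', ‖y‖)‖ ≤ C) →
      ‖iteratedFDeriv ℝ n (radial h) (x, y)‖
        ≤ C * B * ((1 + ‖x‖ + ‖y‖) * (1 + ‖y‖⁻¹)) ^ n := by
  obtain ⟨B, hB1, hB⟩ := exists_norm_iteratedFDeriv_straighten_le n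
  refine ⟨n.factorial * B ^ n, by positivity, fun x y hy => ?_⟩
  obtain ⟨k, hk⟩ := exists_rot_eq_vert_norm y
  have hr : 0 < ‖y‖ := norm_pos_iff.2 hy
  have hs : 0 < 1 + ‖x‖ := by positivity
  have hsl : act k (x, y) ∈ slit := by
    rw [act, hk]
    exact mem_slit_vert _ hr
  refine ⟨(straighten (act k (x, y))).1, norm_straighten_fst hsl |>.trans (norm_rot k x),
    fun h hh C hC => ?_⟩
  have hC0 : 0 ≤ C := (norm_nonneg _).trans (hC 0 (Nat.zero_le _))
  have he := radial_eventuallyEq hh.2 hs hr k hsl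
  rw [(he.iteratedFDeriv ℝ n).eq_of_nhds]
  -- L brings the point to |x| ≤ 1, y = e₃, where the bounds on `straighten` are uniform, and S
  -- undoes the scaling afterwards. The scale 1 + |x| is used for x because it never vanishes and
  -- its inverse is at most 1.
  set S := dilation ℝ (1 + ‖x‖) ‖y‖ with hS
  set L := dilation E3 (1 + ‖x‖)⁻¹ ‖y‖⁻¹ ∘L actL k with hL
  have hLz : L (x, y) = ((1 + ‖x‖)⁻¹ • rot k x, vert 1) := by
    rw [hL, ContinuousLinearMap.comp_apply, actL_apply, dilation_apply, act, hk,
      vert_eq_smul ‖y‖, inv_smul_smul₀ hr.ne']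
  have hxn : ‖(1 + ‖x‖)⁻¹ • rot k x‖ ≤ 1 := by
    rw [norm_smul, norm_rot, norm_inv, Real.norm_of_nonneg hs.le, inv_mul_le_iff₀ hs]
    linarith
  have hLs : L (x, y) ∈ slit := hLz ▸ mem_slit_vert _ one_pos
  have hSn : ‖S‖ ≤ 1 + ‖x‖ + ‖y‖ :=
    norm_dilation_le (by rw [abs_of_pos hs]; linarith) (by rw [abs_of_pos hr]; linarith)
  have hLn : ‖L‖ ≤ 1 + ‖y‖⁻¹ := by
    refine (ContinuousLinearMap.opNorm_comp_le _ _).trans ?_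
    refine (mul_le_of_le_one_right (norm_nonneg _) (norm_actL_le k)).trans ?_
    refine norm_dilation_le ?_ ?_
    · rw [abs_of_pos (by positivity)]
      have h1 : (1 + ‖x‖)⁻¹ ≤ 1 := inv_le_one_of_one_le₀ (by linarith [norm_nonneg x])
      have h2 : 0 < ‖y‖⁻¹ := by positivity
      linarith
    · rw [abs_of_pos (by positivity)]
      linarith
  have hSs : ContDiff ℝ ∞ (h ∘ S) := hh.1.comp S.contDiff
  have hpt : S (straighten (L (x, y))) = ((straighten (act k (x, y))).1, ‖y‖) := by
    rw [hL, ContinuousLinearMap.comp_apply, actL_apply, dilation_apply (V := E3),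
      straighten_smul (inv_pos.2 hr), hS, dilation_apply]
    simp only [smul_inv_smul₀ hs.ne', smul_inv_smul₀ hr.ne']
    congr 1
    exact norm_rot k y
  have h1 : ‖iteratedFDeriv ℝ n ((h ∘ S) ∘ straighten) (L (x, y))‖
      ≤ n.factorial * (C * (1 + ‖x‖ + ‖y‖) ^ n) * B ^ n := by
    rw [← iteratedFDerivWithin_of_isOpen n isOpen_slit hLs]
    refine norm_iteratedFDerivWithin_comp_le hSs.contDiffOn contDiffOn_straighten
      (by exact_mod_cast le_top) uniqueDiffOn_univ isOpen_slit.uniqueDiffOn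
      (Set.mapsTo_univ _ _) hLs ?_ ?_
    · intro i hi
      rw [iteratedFDerivWithin_univ]
      refine (norm_iteratedFDeriv_comp_clm_le isOpen_univ hh.1.contDiffOn S
        (Set.mem_univ _) i).trans ?_
      rw [hpt]
      refine mul_le_mul (hC i hi) ?_ (by positivity) hC0
      refine (pow_le_pow_left₀ (norm_nonneg _) hSn i).trans (pow_le_pow_right₀ ?_ hi)
      linarith [norm_nonneg x]
    · intro i hi1 hi
      rw [iteratedFDerivWithin_of_isOpen i isOpen_slit hLs, hLz]
      exact (hB i hi _ hxn).trans (le_self_pow₀ hB1 (by omega))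
  refine (norm_iteratedFDeriv_comp_clm_le isOpen_slit
    (hSs.comp_contDiffOn contDiffOn_straighten) L hLs n).trans ?_
  calc _ ≤ (n.factorial * (C * (1 + ‖x‖ + ‖y‖) ^ n) * B ^ n) * (1 + ‖y‖⁻¹) ^ n := by
        gcongr
    _ = _ := by rw [mul_pow]; ring

/-! ### Taylor terms and remainders in t. -/

theorem contDiff_ofReal_pow (l : ℕ) : ContDiff ℝ ∞ (fun t : ℝ => (t : ℂ) ^ l) :=
  Complex.ofRealCLM.contDiff.pow l

theorem iteratedDeriv_ofReal_pow_zero (m l : ℕ) :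
    iteratedDeriv m (fun t : ℝ => (t : ℂ) ^ l) 0 = if m = l then (m.factorial : ℂ) else 0 := by
  induction m generalizing l with
  | zero => rcases l with _ | l <;> simp
  | succ m ih =>
    rw [iteratedDeriv_succ']
    rcases l with _ | l
    · simp
    · have hd : deriv (fun t : ℝ => (t : ℂ) ^ (l + 1)) = fun t : ℝ => ((l + 1 : ℕ) : ℂ) * t ^ l := by
        funext t
        have h : HasDerivAt (fun t : ℝ => (t : ℂ) ^ (l + 1))
            (((l + 1 : ℕ) : ℂ) * t ^ l * Complex.ofRealCLM 1) t :=
          (Complex.ofRealCLM.hasDerivAt (x := t)).pow (l + 1)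
        rw [h.deriv]
        simp
      rw [hd, iteratedDeriv_const_mul _ ((contDiff_ofReal_pow l).of_le
        (by exact_mod_cast le_top)).contDiffAt, ih]
      by_cases h : m = l
      · subst h
        simp [Nat.factorial_succ]
      · simp [h]

theorem taylorQ_eq {g : SpacePrime → ℂ} (hg : ContDiff ℝ ∞ g) (M : ℕ) (p : SpacePrime) :
    taylorQ M g p = ((1 / (M.factorial : ℂ)) * (dt^[M] g) (p.1, 0)) * (p.2 : ℂ) ^ M := by
  rw [taylorQ, iteratedDeriv_eq_iterate_dt hg]

theorem contDiff_taylorQ {g : SpacePrime → ℂ} (hg : ContDiff ℝ ∞ g) (M : ℕ) :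
    ContDiff ℝ ∞ (taylorQ M g) := by
  rw [funext (taylorQ_eq hg M)]
  refine ((contDiff_const.mul ?_)).mul ((contDiff_ofReal_pow M).comp contDiff_snd)
  exact (contDiff_iterate_dt hg M).comp (contDiff_fst.prodMk contDiff_const)

theorem iteratedDeriv_comp_mul_left_zero {u : ℝ → ℂ} (hu : ContDiff ℝ ∞ u) (c : ℝ) (m : ℕ) :
    iteratedDeriv m (fun t => u (c * t)) 0 = (c : ℂ) ^ m * iteratedDeriv m u 0 := by
  have h : ∀ (m : ℕ) (u : ℝ → ℂ), ContDiff ℝ ∞ u → ∀ t : ℝ,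
      iteratedDeriv m (fun t => u (c * t)) t = (c : ℂ) ^ m * iteratedDeriv m u (c * t) := by
    intro m
    induction m with
    | zero => simp
    | succ m ih =>
      intro u hu t
      have hu' : ContDiff ℝ ∞ (deriv u) := (contDiff_infty_iff_deriv.1 hu).2
      have hd : deriv (fun t => u (c * t)) = fun t => (c : ℂ) * deriv u (c * t) := by
        funext s
        have h1 : HasDerivAt u (deriv u (c * s)) (c * s) :=
          (hu.differentiable (by simp) _).hasDerivAt
        have h2 := h1.scomp s ((hasDerivAt_id s).const_mul c)
        exact h2.deriv.trans (by simp)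
      have hs : ContDiff ℝ ∞ (fun t => deriv u (c * t)) :=
        hu'.comp (contDiff_const.mul contDiff_id)
      rw [iteratedDeriv_succ', iteratedDeriv_succ', hd, iteratedDeriv_const_mul _
        (hs.of_le (by exact_mod_cast le_top)).contDiffAt, ih _ hu']
      ring
  simpa using h m u hu 0

/-- An element k of K' multiplies t by its lower right entry c. Differentiating g(kx, cs) = g(x, s)
at s = 0 produces the factor c^M that (ct)^M contributes to Q_M(kx, ct). -/
theorem taylorQ_mem {g : SpacePrime → ℂ} (hg : g ∈ smoothInvPrime) (M : ℕ) :
    taylorQ M g ∈ smoothInvPrime := by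
  refine ⟨contDiff_taylorQ hg.1 M, fun k p => ?_⟩
  obtain ⟨x, t⟩ := p
  obtain ⟨c, hc⟩ : ∃ c, c = ((k : K) : Matrix (Fin 3) (Fin 3) ℝ) 2 2 := ⟨_, rfl⟩
  have hk : ∀ s : ℝ, g (rot k x, c * s) = g (x, s) := by
    intro s
    rw [← hg.2 k (x, s), actPrime, rot_vert_two, hc]
  have hu : ContDiff ℝ ∞ fun s : ℝ => g (rot k x, s) :=
    hg.1.comp (contDiff_const.prodMk contDiff_id)
  have h := iteratedDeriv_comp_mul_left_zero hu c M
  simp only [hk] at h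
  simp only [taylorQ, actPrime, rot_vert_two, ← hc, h]
  push_cast
  ring

/-- The Taylor remainder of `g` of order `M` in the second variable. -/
noncomputable def remainder (M : ℕ) (g : SpacePrime → ℂ) : SpacePrime → ℂ :=
  fun p => g p - ∑ m ∈ Finset.range M, taylorQ m g p

theorem remainder_mem {g : SpacePrime → ℂ} (hg : g ∈ smoothInvPrime) (M : ℕ) :
    remainder M g ∈ smoothInvPrime :=
  ⟨hg.1.sub (ContDiff.sum fun m _ => contDiff_taylorQ hg.1 m), fun k p => by
    simp only [remainder, hg.2 k p, (taylorQ_mem hg _).2 k p]⟩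

theorem iterate_dt_remainder {g : SpacePrime → ℂ} (hg : g ∈ smoothInvPrime) (M : ℕ) :
    ∀ m < M, ∀ x, (dt^[m] (remainder M g)) (x, 0) = 0 := by
  intro m hm x
  have h := congrFun (iteratedDeriv_eq_iterate_dt (remainder_mem hg M).1 m x) 0
  have h1 : ContDiff ℝ m fun t : ℝ => g (x, t) :=
    (hg.1.comp (contDiff_const.prodMk contDiff_id)).of_le (by exact_mod_cast le_top)
  have h2 : ∀ l, ContDiff ℝ m fun t : ℝ => taylorQ l g (x, t) := fun l =>
    ((contDiff_taylorQ hg.1 l).comp (contDiff_const.prodMk contDiff_id)).of_le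
      (by exact_mod_cast le_top)
  rw [← h]
  simp only [remainder]
  rw [iteratedDeriv_fun_sub h1.contDiffAt (ContDiff.sum fun l _ => h2 l).contDiffAt,
    iteratedDeriv_fun_sum fun l _ => (h2 l).contDiffAt]
  have h3 : ∀ l, iteratedDeriv m (fun t : ℝ => taylorQ l g (x, t)) 0
      = if m = l then iteratedDeriv m (fun t : ℝ => g (x, t)) 0 else 0 := by
    intro l
    simp only [taylorQ]
    rw [iteratedDeriv_const_mul _ ((contDiff_ofReal_pow l).of_le
        (by exact_mod_cast le_top)).contDiffAt, iteratedDeriv_ofReal_pow_zero]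
    by_cases hml : m = l
    · subst hml
      have : (m.factorial : ℂ) ≠ 0 := by exact_mod_cast m.factorial_ne_zero
      simp only [if_true]
      field_simp
    · simp [hml]
  simp only [h3]
  rw [Finset.sum_ite_eq, if_pos (Finset.mem_range.2 hm), sub_self]

/-- The radialisation of a function that is flat of order `M` along `y = 0` is controlled by the
derivatives of order `M` of this function. -/
theorem norm_iteratedFDeriv_radial_le_of_flat (n : ℕ) : ∃ B : ℝ, 0 ≤ B ∧
    ∀ h ∈ smoothInvPrime, ∀ M : ℕ, 2 * n ≤ M → (∀ m < M, ∀ x, (dt^[m] h) (x, 0) = 0) →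
    ∀ (x y : E3) (C : ℝ), y ≠ 0 → ‖y‖ ≤ 1 →
    (∀ (x' : E3) (s : ℝ), ‖x'‖ = ‖x‖ → ‖s‖ ≤ 1 → ‖iteratedFDeriv ℝ M h (x', s)‖ ≤ C) →
    ‖iteratedFDeriv ℝ n (radial h) (x, y)‖ ≤ C * B * (1 + ‖x‖) ^ n * ‖y‖ ^ (M - 2 * n) := by
  obtain ⟨B, hB0, hB⟩ := norm_iteratedFDeriv_radial_le n
  refine ⟨B * 4 ^ n, by positivity, fun h hh M hM h0 x y C hy hy1 hC => ?_⟩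
  have hr : 0 < ‖y‖ := norm_pos_iff.2 hy
  have hC0 : 0 ≤ C := (norm_nonneg _).trans (hC x 0 rfl (by simp))
  obtain ⟨x', hx', hmain⟩ := hB x y hy
  have h1 := hmain h hh (C * ‖y‖ ^ (M - n)) ?_
  · refine h1.trans ?_
    have h2 : (1 + ‖x‖ + ‖y‖) * (1 + ‖y‖⁻¹) ≤ 4 * (1 + ‖x‖) * ‖y‖⁻¹ := by
      have e1 : 1 + ‖x‖ + ‖y‖ ≤ 2 * (1 + ‖x‖) := by linarith [norm_nonneg x]
      have e2 : 1 + ‖y‖⁻¹ ≤ 2 * ‖y‖⁻¹ := by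
        linarith [(one_le_inv₀ hr).2 hy1]
      calc _ ≤ (2 * (1 + ‖x‖)) * (2 * ‖y‖⁻¹) := by gcongr
        _ = _ := by ring
    calc _ ≤ C * ‖y‖ ^ (M - n) * B * (4 * (1 + ‖x‖) * ‖y‖⁻¹) ^ n := by gcongr
      _ = C * (B * 4 ^ n) * (1 + ‖x‖) ^ n * (‖y‖ ^ (M - n) * ‖y‖⁻¹ ^ n) := by
        rw [mul_pow, mul_pow]; ring
      _ = _ := by
        -- Of the exponent M - n given by flatness, n is spent on the singular factor |y|⁻ⁿ.
        have : M - n = (M - 2 * n) + n := by omega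
        rw [this, pow_add, mul_assoc (‖y‖ ^ (M - 2 * n)), ← mul_pow, mul_inv_cancel₀ hr.ne',
          one_pow, mul_one]
  · intro i hi
    have h3 := norm_iteratedFDeriv_le_of_flat hh.1 h0 (fun s hs => hC x' s hx' hs) (M - i)
      (by omega) ‖y‖ (by rwa [norm_norm])
    rw [show M - (M - i) = i by omega, norm_norm] at h3
    refine h3.trans ?_
    gcongr C * ?_
    exact pow_le_pow_of_le_one hr.le hy1 (by omega)

/-! ### Smooth extension across y = 0. -/

/-- The extension of the radialisation of `g` to the points `(x, 0)`. -/
noncomputable def extension (g : SpacePrime → ℂ) (p : Space) : ℂ :=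
  open Classical in if p.2 = 0 then g (p.1, 0) else radial g p

theorem extension_eq_radial (g : SpacePrime → ℂ) {p : Space} (hp : p.2 ≠ 0) :
    extension g p = radial g p := if_neg hp

theorem rest_extension {g : SpacePrime → ℂ} (hg : g ∈ smoothInvPrime) :
    rest (extension g) = g := by
  funext ⟨x, t⟩
  by_cases ht : t = 0
  · subst ht
    exact if_pos vert_zero
  · exact (extension_eq_radial g (vert_ne_zero ht)).trans (radial_vert hg.2 x ht)

/-- The pair (k, t) chosen in `radial` depends on the point only, so radialisation is linear. -/
theorem radial_eq_sum_add (g : SpacePrime → ℂ) (M : ℕ) (p : Space) :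
    radial g p = ∑ m ∈ Finset.range M, radial (taylorQ m g) p + radial (remainder M g) p := by
  simp [radial, remainder]

theorem IsHomogeneousInY.apply_zero {M : ℕ} {P : Space → ℂ} (h : IsHomogeneousInY M P)
    (hM : M ≠ 0) (x : E3) : P (x, 0) = 0 := by
  obtain ⟨c, -, hc⟩ := h
  rw [hc]
  refine Finset.sum_eq_zero fun j hj => ?_
  have hj' : ∑ i, j i = M := (Finset.mem_piAntidiag.1 hj).1
  obtain ⟨i, -, hi⟩ := Finset.exists_ne_zero_of_sum_ne_zero (hj'.trans_ne hM)
  have : monom j 0 = 0 := Finset.prod_eq_zero (Finset.mem_univ i) (by simp [hi])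
  rw [this, mul_zero]

theorem IsHomogeneousInY.apply_eq {P : Space → ℂ} (h : IsHomogeneousInY 0 P) (x y y' : E3) :
    P (x, y) = P (x, y') := by
  obtain ⟨c, -, hc⟩ := h
  rw [hc, hc]
  refine Finset.sum_congr rfl fun j hj => ?_
  have hj' : ∑ i, j i = 0 := (Finset.mem_piAntidiag.1 hj).1
  simp [monom, fun i => (Finset.sum_eq_zero_iff.1 hj') i (Finset.mem_univ i)]

/-- At y = 0 the terms of positive degree vanish, while the term of degree 0 is constant in y and
can be read off at e₃, where it equals g(x, 0). This term must be present, hence M ≠ 0. -/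
theorem extension_eq_sum_add {g : SpacePrime → ℂ} (hg : g ∈ smoothInvPrime) {P : ℕ → Space → ℂ}
    (hhom : ∀ M, IsHomogeneousInY M (P M))
    (hPr : ∀ M, ∀ p ∈ regularPart, P M p = radial (taylorQ M g) p)
    {M : ℕ} (hM : M ≠ 0) (p : Space) :
    extension g p = ∑ m ∈ Finset.range M, P m p +
      (open Classical in if p.2 = 0 then 0 else radial (remainder M g) p) := by
  obtain ⟨x, y⟩ := p
  by_cases hy : y = 0
  · subst hy
    obtain ⟨M, rfl⟩ := Nat.exists_eq_succ_of_ne_zero hM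
    rw [Finset.sum_range_succ', Finset.sum_eq_zero fun m _ =>
      (hhom (m + 1)).apply_zero m.succ_ne_zero x, (hhom 0).apply_eq x 0 (vert 1),
      hPr 0 _ (vert_ne_zero one_ne_zero), radial_vert (taylorQ_mem hg 0).2 x one_ne_zero]
    simp [extension, taylorQ]
  · rw [extension_eq_radial g hy, if_neg hy, radial_eq_sum_add g M]
    congr 1
    exact Finset.sum_congr rfl fun m _ => (hPr m _ hy).symm

theorem contDiff_extension {g : SpacePrime → ℂ} (hg : g ∈ smoothInvPrime) {P : ℕ → Space → ℂ}
    (hP : ∀ M, ContDiff ℝ ∞ (P M)) (hhom : ∀ M, IsHomogeneousInY M (P M))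
    (hPr : ∀ M, ∀ p ∈ regularPart, P M p = radial (taylorQ M g) p) : ContDiff ℝ ∞ (extension g) := by
  classical
  rw [contDiff_infty]
  intro N
  -- With 2N + 2 terms removed, the exponent 2N + 2 - 2n is at least 2 for every n ≤ N, as the
  -- gluing criterion demands.
  rw [funext (extension_eq_sum_add hg hhom hPr (M := 2 * N + 2) (by omega))]
  refine (ContDiff.sum fun m _ => (hP m).of_le (by exact_mod_cast le_top)).add ?_
  have hR := remainder_mem hg (2 * N + 2)
  have he : ∀ p : Space, p.2 ≠ 0 →
      (fun p : Space => if p.2 = 0 then 0 else radial (remainder (2 * N + 2) g) p)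
        =ᶠ[nhds p] radial (remainder (2 * N + 2) g) := by
    intro p hp
    filter_upwards [(isOpen_ne_fun continuous_snd continuous_const).mem_nhds hp] with q hq
    exact if_neg hq
  refine contDiff_of_norm_iteratedFDeriv_le_sq N (fun x => if_pos rfl)
    (fun p hp => (contDiffAt_radial hR hp).congr_of_eventuallyEq (he p hp)) ?_
  intro n hn ρ
  obtain ⟨B, hB0, hB⟩ := norm_iteratedFDeriv_radial_le_of_flat n
  obtain ⟨C, hC⟩ := ((isCompact_closedBall (0 : E3) ρ).prod
    (isCompact_closedBall (0 : ℝ) 1)).exists_bound_of_continuousOn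
    (hR.1.continuous_iteratedFDeriv (m := 2 * N + 2) (WithTop.coe_le_coe.2 le_top)).continuousOn
  refine ⟨C * B * (1 + ρ) ^ n, fun x y hx hy hy1 => ?_⟩
  rw [((he (x, y) hy).iteratedFDeriv ℝ n).eq_of_nhds]
  have hb : ∀ (x' : E3) (s : ℝ), ‖x'‖ = ‖x‖ → ‖s‖ ≤ 1 →
      ‖iteratedFDeriv ℝ (2 * N + 2) (remainder (2 * N + 2) g) (x', s)‖ ≤ C :=
    fun x' s hx' hs => hC (x', s) ⟨by simpa [hx'] using hx, by simpa using hs⟩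
  have hC0 : 0 ≤ C := (norm_nonneg _).trans (hb x 0 rfl (by simp))
  refine (hB _ hR _ (by omega) (iterate_dt_remainder hg _) x y C hy hy1 hb).trans ?_
  refine mul_le_mul ?_ (pow_le_pow_of_le_one (norm_nonneg y) hy1 (by omega)) (by positivity) ?_
  · gcongr
  · have : 0 ≤ ρ := (norm_nonneg x).trans hx
    positivity

theorem dense_regularPart : Dense regularPart := by
  have h : Dense ((Set.univ : Set E3) ×ˢ ({0}ᶜ : Set E3)) :=
    dense_univ.prod (dense_compl_singleton 0)
  refine h.mono ?_
  rintro p ⟨-, hp⟩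
  exact hp

theorem extension_act {g : SpacePrime → ℂ} (hg : g ∈ smoothInvPrime)
    (hc : Continuous (extension g)) (k : K) (p : Space) :
    extension g (act k p) = extension g p := by
  refine congrFun (Continuous.ext_on dense_regularPart (hc.comp (actL k).continuous) hc ?_) p
  intro q hq
  change extension g (act k q) = extension g q
  rw [extension_eq_radial g hq, extension_eq_radial g (p := act k q) (rot_ne_zero k hq),
    radial_act hg.2 k hq]

/-! ### Taylor parts of invariant functions and necessity of Property (R). -/

theorem contDiff_pderiv {F : E3 → ℂ} (hF : ContDiff ℝ ∞ F) (i : Fin 3) :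
    ContDiff ℝ ∞ (pderiv i F) :=
  (hF.fderiv_right (m := ∞) (by simp)).clm_apply contDiff_const

theorem iteratedDeriv_comp_vert {F : E3 → ℂ} (hF : ContDiff ℝ ∞ F) (M : ℕ) :
    iteratedDeriv M (fun t => F (vert t)) = fun t => ((pderiv 2)^[M] F) (vert t) := by
  induction M generalizing F with
  | zero => simp
  | succ M ih =>
    rw [iteratedDeriv_succ', Function.iterate_succ_apply, ← ih (contDiff_pderiv hF 2)]
    congr 1
    funext t
    have h1 : HasFDerivAt F (fderiv ℝ F (vert t)) (vert t) :=
      (hF.differentiable (by simp) _).hasFDerivAt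
    have h2 : HasDerivAt vert (EuclideanSpace.single 2 1) t := by
      have e1 : (EuclideanSpace.single 2 1 : E3) = (1 : ℝ) • vert 1 := by
        ext i
        fin_cases i <;> simp [vert]
      rw [e1]
      refine HasDerivAt.congr_of_eventuallyEq ?_ (Filter.Eventually.of_forall fun s => vert_eq_smul s)
      exact (hasDerivAt_id t).smul_const (vert 1)
    exact (h1.comp_hasDerivAt t h2).deriv

theorem monom_vert {M : ℕ} {j : Fin 3 → ℕ} (hj : j ∈ multiIndices M) (hne : j ≠ Pi.single 2 M)
    (t : ℝ) : monom j (vert t) = 0 := by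
  have hs : j 0 + j 1 + j 2 = M := by
    rw [← Fin.sum_univ_three]
    exact (Finset.mem_piAntidiag.1 hj).1
  have h : j 0 ≠ 0 ∨ j 1 ≠ 0 := by
    by_contra! h
    apply hne
    funext i
    fin_cases i
    · simpa using h.1
    · simpa using h.2
    · simpa [h.1, h.2] using hs
  rw [monom, Fin.prod_univ_three]
  rcases h with h | h <;> simp [vert, h]

/-- On the vertical axis every monomial of degree M except y₃^M vanishes. -/
theorem taylorQ_rest {f : Space → ℂ} (hf : ContDiff ℝ ∞ f) (M : ℕ) :
    taylorQ M (rest f) = rest (taylorP M f) := by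
  funext ⟨x, t⟩
  have hF : ContDiff ℝ ∞ fun y => f (x, y) := hf.comp (contDiff_const.prodMk contDiff_id)
  simp only [rest, taylorP, taylorQ]
  rw [iteratedDeriv_comp_vert hF, Finset.sum_eq_single (Pi.single 2 M)]
  · rw [Fin.prod_univ_three, monom, Fin.prod_univ_three]
    simp [mderiv, vert_zero]
    left
    simp [vert]
  · intro j hj hne
    rw [monom_vert hj hne, mul_zero]
  · intro h
    exact absurd (by simp [multiIndices, Finset.mem_piAntidiag]) h

/-- The homogeneous part of degree `M` in `y` of the Taylor expansion of `f` along `y = 0`. -/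
noncomputable def homogeneousPart (M : ℕ) (f : Space → ℂ) (p : Space) : ℂ :=
  (1 / (M.factorial : ℂ)) * iteratedFDeriv ℝ M f (p.1, 0) fun _ => (0, p.2)

theorem homogeneousPart_vert {f : Space → ℂ} (hf : ContDiff ℝ ∞ f) (M : ℕ) (x : E3) (t : ℝ) :
    homogeneousPart M f (x, vert t) = taylorQ M (rest f) (x, t) := by
  let L : ℝ →L[ℝ] Space := ContinuousLinearMap.toSpanSingleton ℝ ((0, vert 1) : Space)
  have hL : ∀ s, L s = (0, vert s) := by
    intro s
    rw [vert_eq_smul s]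
    simp [L, ContinuousLinearMap.toSpanSingleton_apply]
  have hu : (fun s : ℝ => f (x, vert s)) = (fun z => f ((x, 0) + z)) ∘ L := by
    funext s
    simp [hL]
  have hs : ContDiff ℝ ∞ fun z : Space => f ((x, 0) + z) := hf.comp (contDiff_const.add contDiff_id)
  have h : iteratedDeriv M (fun s : ℝ => f (x, vert s)) 0
      = iteratedFDeriv ℝ M f (x, 0) fun _ => (0, vert 1) := by
    rw [iteratedDeriv_eq_iteratedFDeriv, hu, L.iteratedFDeriv_comp_right hs 0
      (WithTop.coe_le_coe.2 le_top), iteratedFDeriv_comp_add_left]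
    simp [hL, vert_zero]
  have h2 : (fun _ : Fin M => ((0, vert t) : Space)) = fun _ => t • ((0, vert 1) : Space) := by
    rw [vert_eq_smul t]
    simp
  simp only [taylorQ, rest, homogeneousPart, h, h2]
  rw [ContinuousMultilinearMap.map_smul_univ]
  simp
  ring

/-- Chain rule for the linear map `actL k`, which fixes y = 0 as a set. Writing the Taylor part with
the full M-th derivative, rather than with multi-indices, makes its invariance immediate. -/
theorem homogeneousPart_act {f : Space → ℂ} (hf : f ∈ smoothInv) (M : ℕ) (k : K) (p : Space) :
    homogeneousPart M f (act k p) = homogeneousPart M f p := by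
  have h : f ∘ actL k = f := funext fun p => hf.2 k p
  have h1 := (actL k).iteratedFDeriv_comp_right hf.1 (p.1, 0) (i := M)
    (WithTop.coe_le_coe.2 le_top)
  rw [h] at h1
  simp only [homogeneousPart, h1]
  simp [actL_apply, act, rot_zero]

theorem contDiff_iteratedFDeriv_apply {f : Space → ℂ} (hf : ContDiff ℝ ∞ f) (M : ℕ)
    (v : Fin M → Space) : ContDiff ℝ ∞ fun x : E3 => iteratedFDeriv ℝ M f (x, 0) v := by
  have h : ContDiff ℝ ∞ (iteratedFDeriv ℝ M f) :=
    hf.iteratedFDeriv_right (by exact_mod_cast le_top)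
  exact (ContinuousMultilinearMap.apply ℝ (fun _ : Fin M => Space) ℂ v).contDiff.comp
    (h.comp (contDiff_id.prodMk contDiff_const))

theorem contDiff_monom (j : Fin 3 → ℕ) : ContDiff ℝ ∞ (monom j) :=
  contDiff_prod fun i _ => (Complex.ofRealCLM.contDiff.comp
    (EuclideanSpace.proj (𝕜 := ℝ) i).contDiff).pow _

theorem isHomogeneousInY_homogeneousPart {f : Space → ℂ} (hf : ContDiff ℝ ∞ f) (M : ℕ) :
    IsHomogeneousInY M (homogeneousPart M f) := by
  classical
  let e : Fin 3 → Space := fun i => (0, EuclideanSpace.single i 1)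
  -- Expanding the M-linear form over the basis gives one term per r : Fin M → Fin 3; terms are
  -- grouped by the multi-index counting how often r takes each value.
  let count : (Fin M → Fin 3) → Fin 3 → ℕ := fun r i => (Finset.univ.filter fun a => r a = i).card
  refine ⟨fun j x => (1 / (M.factorial : ℂ)) *
    ∑ r ∈ Finset.univ.filter fun r => count r = j, iteratedFDeriv ℝ M f (x, 0) fun a => e (r a),
    fun j _ => contDiff_const.mul (ContDiff.sum fun r _ => contDiff_iteratedFDeriv_apply hf M _),
    fun x y => ?_⟩
  have hy : (fun _ : Fin M => ((0, y) : Space)) = fun _ => ∑ i, y i • e i := by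
    funext _
    refine Prod.ext ?_ ?_
    · simp [e, Prod.fst_sum]
    · rw [Prod.snd_sum]
      ext i
      simp [e, Finset.sum_apply, Pi.single_apply]
  have hmem : ∀ r, count r ∈ multiIndices M := by
    intro r
    refine Finset.mem_piAntidiag.2 ⟨?_, fun i _ => Finset.mem_univ i⟩
    have := Finset.card_eq_sum_card_fiberwise (f := r) (s := Finset.univ) (t := Finset.univ)
      (fun _ _ => Finset.mem_coe.2 (Finset.mem_univ _))
    rw [Finset.card_univ, Fintype.card_fin] at this
    exact this.symm
  have hterm : ∀ r : Fin M → Fin 3, (iteratedFDeriv ℝ M f (x, 0) fun a => y (r a) • e (r a))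
      = (iteratedFDeriv ℝ M f (x, 0) fun a => e (r a)) * monom (count r) y := by
    intro r
    rw [ContinuousMultilinearMap.map_smul_univ, monom,
      ← Finset.prod_fiberwise' Finset.univ r fun i => y i]
    simp [count, Finset.prod_const, mul_comm]
  have hsum : (iteratedFDeriv ℝ M f (x, 0) fun _ => ((0, y) : Space))
      = ∑ r : Fin M → Fin 3, iteratedFDeriv ℝ M f (x, 0) fun a => y (r a) • e (r a) := by
    rw [hy]
    exact (iteratedFDeriv ℝ M f (x, 0)).toMultilinearMap.map_sum fun _ i => y i • e i
  simp only [homogeneousPart, hsum, hterm]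
  rw [← Finset.sum_fiberwise_of_maps_to (s := Finset.univ) (t := multiIndices M)
    (fun r _ => hmem r), Finset.mul_sum]
  refine Finset.sum_congr rfl fun j _ => ?_
  rw [mul_assoc, Finset.sum_mul]
  congr 1
  refine Finset.sum_congr rfl fun r hr => ?_
  rw [(Finset.mem_filter.1 hr).2]

theorem IsHomogeneousInY.contDiff {M : ℕ} {P : Space → ℂ} (h : IsHomogeneousInY M P) :
    ContDiff ℝ ∞ P := by
  obtain ⟨c, hc, hP⟩ := h
  have : P = fun p => ∑ j ∈ multiIndices M, c j p.1 * monom j p.2 := funext fun p => hP p.1 p.2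
  rw [this]
  exact ContDiff.sum fun j hj => ((hc j hj).comp contDiff_fst).mul
    ((contDiff_monom j).comp contDiff_snd)

/-- Both the Taylor part of f and Radial(Q_M) are constant on K-orbits, and they agree at the points
(x, (0, 0, t)), which every orbit meets. -/
theorem propertyR_rest {f : Space → ℂ} (hf : f ∈ smoothInv) (hg : rest f ∈ smoothInvPrime) :
    PropertyR (rest f) := by
  intro M
  have h := isHomogeneousInY_homogeneousPart hf.1 M
  refine ⟨homogeneousPart M f, h.contDiff, h, fun p hp => ?_⟩
  obtain ⟨x, y⟩ := p
  obtain ⟨k, t, hk⟩ := exists_rot_vert y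
  rw [radial_eq (taylorQ_mem hg M).2 x y hp k t hk, ← homogeneousPart_vert hf.1 M,
    ← homogeneousPart_act hf M k (rot k⁻¹ x, vert t), act, rot_rot_inv, ← hk]

/-! ### Schwartz functions and decay on the strip |y| ≤ 1. -/

section Schwartz

variable {D E V : Type} [NormedAddCommGroup D] [NormedSpace ℝ D] [NormedAddCommGroup E]
  [NormedSpace ℝ E] [NormedAddCommGroup V] [NormedSpace ℝ V]

theorem IsSchwartz.comp_clm {f : E → ℂ} (hf : IsSchwartz f) (L : D →L[ℝ] E)
    (hL : ∀ x, ‖x‖ ≤ ‖L x‖) : IsSchwartz fun x => f (L x) := by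
  obtain ⟨φ, rfl⟩ := hf
  exact ⟨SchwartzMap.compCLM ℝ L.hasTemperateGrowth
    ⟨1, 1, fun x => by rw [one_mul, pow_one]; linarith [hL x]⟩ φ, rfl⟩

theorem IsSchwartz.const_mul {f : E → ℂ} (hf : IsSchwartz f) (c : ℂ) :
    IsSchwartz fun x => c * f x := by
  obtain ⟨φ, rfl⟩ := hf
  exact ⟨c • φ, rfl⟩

theorem IsSchwartz.sum {ι : Type} {s : Finset ι} {f : ι → E → ℂ}
    (hf : ∀ i ∈ s, IsSchwartz (f i)) : IsSchwartz fun x => ∑ i ∈ s, f i x := by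
  classical
  induction s using Finset.induction_on with
  | empty => exact ⟨0, by funext x; simp⟩
  | insert a s ha ih =>
    obtain ⟨φ, hφ⟩ := hf a (Finset.mem_insert_self a s)
    obtain ⟨ψ, hψ⟩ := ih fun i hi => hf i (Finset.mem_insert_of_mem hi)
    refine ⟨φ + ψ, ?_⟩
    funext x
    rw [Finset.sum_insert ha, ← hφ, add_apply, congrFun hψ x]

theorem IsSchwartz.contDiff {f : E → ℂ} (hf : IsSchwartz f) : ContDiff ℝ ∞ f := by
  obtain ⟨φ, rfl⟩ := hf
  exact φ.smooth ⊤

theorem IsSchwartz.exists_bound {f : E → ℂ} (hf : IsSchwartz f) (k n : ℕ) :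
    ∃ C : ℝ, ∀ i ≤ n, ∀ x, (1 + ‖x‖) ^ k * ‖iteratedFDeriv ℝ i f x‖ ≤ C := by
  obtain ⟨φ, rfl⟩ := hf
  exact ⟨_, fun i hi x =>
    SchwartzMap.one_add_le_sup_seminorm_apply (𝕜 := ℝ) (m := (k, n)) le_rfl hi φ x⟩

theorem IsSchwartz.dt {h : E × ℝ → ℂ} (hh : IsSchwartz h) : IsSchwartz (dt h) := by
  obtain ⟨φ, rfl⟩ := hh
  exact ⟨SchwartzMap.evalCLM ℝ (E × ℝ) ℂ (0, 1) (SchwartzMap.fderivCLM ℝ (E × ℝ) ℂ φ), rfl⟩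

theorem IsSchwartz.iterate_dt {h : E × ℝ → ℂ} (hh : IsSchwartz h) (m : ℕ) :
    IsSchwartz (RadialExtension.dt^[m] h) := by
  induction m generalizing h with
  | zero => exact hh
  | succ m ih => exact ih hh.dt

theorem IsSchwartz.slice {h : E × V → ℂ} (hh : IsSchwartz h) : IsSchwartz fun x => h (x, 0) :=
  hh.comp_clm (ContinuousLinearMap.inl ℝ E V) fun x => by simp

/-- The derivatives of `h` decay rapidly in `x` on the strip of the points `(x, y)` with
`|y| ≤ 1`. -/
def StripDecay (h : E × V → ℂ) : Prop :=
  ∀ k n : ℕ, ∃ C : ℝ, ∀ x y, ‖y‖ ≤ 1 → (1 + ‖x‖) ^ k * ‖iteratedFDeriv ℝ n h (x, y)‖ ≤ C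

theorem IsSchwartz.stripDecay {h : E × V → ℂ} (hh : IsSchwartz h) : StripDecay h := by
  intro k n
  obtain ⟨C, hC⟩ := hh.exists_bound k n
  refine ⟨C, fun x y _ => (mul_le_mul_of_nonneg_right ?_ (norm_nonneg _)).trans
    (hC n le_rfl (x, y))⟩
  gcongr
  exact norm_fst_le (x, y)

theorem StripDecay.sum {ι : Type} {s : Finset ι} {f : ι → E × V → ℂ}
    (hf : ∀ i ∈ s, StripDecay (f i)) (hs : ∀ i ∈ s, ContDiff ℝ ∞ (f i)) :
    StripDecay fun p => ∑ i ∈ s, f i p := by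
  intro k n
  have h : ∀ i, ∃ C : ℝ, i ∈ s → ∀ x y, ‖y‖ ≤ 1 →
      (1 + ‖x‖) ^ k * ‖iteratedFDeriv ℝ n (f i) (x, y)‖ ≤ C := by
    intro i
    by_cases hi : i ∈ s
    · obtain ⟨C, hC⟩ := hf i hi k n
      exact ⟨C, fun _ => hC⟩
    · exact ⟨0, fun h => absurd h hi⟩
  choose C hC using h
  refine ⟨∑ i ∈ s, C i, fun x y hy => ?_⟩
  rw [iteratedFDeriv_sum fun i hi => (hs i hi).of_le (WithTop.coe_le_coe.2 le_top),
    Finset.sum_apply]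
  refine (mul_le_mul_of_nonneg_left (norm_sum_le _ _) (by positivity)).trans ?_
  rw [Finset.mul_sum]
  exact Finset.sum_le_sum fun i hi => hC i hi x y hy

theorem StripDecay.sub {f h : E × V → ℂ} (hf : StripDecay f) (hh : StripDecay h)
    (hfs : ContDiff ℝ ∞ f) (hhs : ContDiff ℝ ∞ h) : StripDecay fun p => f p - h p := by
  intro k n
  obtain ⟨C₁, h₁⟩ := hf k n
  obtain ⟨C₂, h₂⟩ := hh k n
  refine ⟨C₁ + C₂, fun x y hy => ?_⟩
  have e : iteratedFDeriv ℝ n (fun p => f p - h p) (x, y)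
      = iteratedFDeriv ℝ n f (x, y) - iteratedFDeriv ℝ n h (x, y) :=
    iteratedFDeriv_sub_apply (hfs.of_le (WithTop.coe_le_coe.2 le_top)).contDiffAt
      (hhs.of_le (WithTop.coe_le_coe.2 le_top)).contDiffAt
  rw [e]
  refine (mul_le_mul_of_nonneg_left (norm_sub_le _ _) (by positivity)).trans ?_
  rw [mul_add]
  exact add_le_add (h₁ x y hy) (h₂ x y hy)

theorem norm_iteratedFDeriv_comp_le_of_norm_le_one {f : E → ℂ} (hf : ContDiff ℝ ∞ f)
    {L : D →L[ℝ] E} (hL : ‖L‖ ≤ 1) (n : ℕ) (x : D) :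
    ‖iteratedFDeriv ℝ n (fun p => f (L p)) x‖ ≤ ‖iteratedFDeriv ℝ n f (L x)‖ :=
  (norm_iteratedFDeriv_comp_clm_le isOpen_univ hf.contDiffOn L (Set.mem_univ _) n).trans
    (mul_le_of_le_one_right (norm_nonneg _) (pow_le_one₀ (norm_nonneg _) hL))

/-- Leibniz rule; q need not decay, as its derivatives are bounded on the compact unit ball. -/
theorem IsSchwartz.stripDecay_mul [ProperSpace V] {a : E → ℂ} (ha : IsSchwartz a) {q : V → ℂ}
    (hq : ContDiff ℝ ∞ q) : StripDecay fun p : E × V => a p.1 * q p.2 := by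
  intro k n
  obtain ⟨C, hC⟩ := ha.exists_bound k n
  have hb : ∀ i : ℕ, ∃ A : ℝ, ∀ y, ‖y‖ ≤ 1 → ‖iteratedFDeriv ℝ i q y‖ ≤ A := by
    intro i
    obtain ⟨A, hA⟩ := (isCompact_closedBall (0 : V) 1).exists_bound_of_continuousOn
      (hq.continuous_iteratedFDeriv (m := i) (WithTop.coe_le_coe.2 le_top)).continuousOn
    exact ⟨A, fun y hy => hA y (by simpa using hy)⟩
  choose A hA using hb
  refine ⟨∑ i ∈ Finset.range (n + 1), (n.choose i : ℝ) * C * A (n - i), fun x y hy => ?_⟩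
  have h1 := norm_iteratedFDeriv_mul_le (n := n) (ha.contDiff.comp (contDiff_fst (F := V)))
    (hq.comp (contDiff_snd (E := E))) (x, y) (WithTop.coe_le_coe.2 le_top)
  refine (mul_le_mul_of_nonneg_left h1 (by positivity)).trans ?_
  rw [Finset.mul_sum]
  refine Finset.sum_le_sum fun i hi => ?_
  have h2 : ‖iteratedFDeriv ℝ i (a ∘ Prod.fst) (x, y)‖ ≤ ‖iteratedFDeriv ℝ i a x‖ :=
    norm_iteratedFDeriv_comp_le_of_norm_le_one ha.contDiff
      (ContinuousLinearMap.norm_fst_le ℝ E V) i (x, y)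
  have h3 : ‖iteratedFDeriv ℝ (n - i) (q ∘ Prod.snd) (x, y)‖ ≤ A (n - i) :=
    (norm_iteratedFDeriv_comp_le_of_norm_le_one hq
      (ContinuousLinearMap.norm_snd_le ℝ E V) (n - i) (x, y)).trans (hA _ y hy)
  have h4 := hC i (by have := Finset.mem_range.1 hi; omega) x
  have hC0 : 0 ≤ C := le_trans (by positivity) h4
  calc _ = (n.choose i : ℝ) * ((1 + ‖x‖) ^ k * ‖iteratedFDeriv ℝ i (a ∘ Prod.fst) (x, y)‖)
        * ‖iteratedFDeriv ℝ (n - i) (q ∘ Prod.snd) (x, y)‖ := by ring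
    _ ≤ (n.choose i : ℝ) * C * A (n - i) := by
      gcongr
      exact (mul_le_mul_of_nonneg_left h2 (by positivity)).trans h4

end Schwartz

/-! ### Schwartz estimates for the extension. -/

/-- The value of a coefficient of a homogeneous polynomial is a linear combination of values of
the polynomial at finitely many nonzero points. -/
theorem exists_interpolation (M : ℕ) (j : Fin 3 → ℕ) (hj : j ∈ multiIndices M) :
    ∃ (ι : Type) (_ : Fintype ι) (y : ι → E3) (b : ι → ℂ), (∀ l, y l ≠ 0) ∧
      ∀ j' ∈ multiIndices M, ∑ l, b l * monom j' (y l) = if j' = j then 1 else 0 := by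
  have hle : ∀ {i : Fin 3 → ℕ}, i ∈ multiIndices M → ∀ a, i a < M + 1 := by
    intro i hi a
    have hs : ∑ a, i a = M := (Finset.mem_piAntidiag.1 hi).1
    have := Finset.single_le_sum (f := i) (fun _ _ => Nat.zero_le _) (Finset.mem_univ a)
    omega
  -- The nodes start at 1 so that no interpolation point is 0, where the radialisation gives no
  -- information. The weights are products over the three coordinates of entries of the inverse
  -- Vandermonde matrix.
  let v : Fin (M + 1) → ℂ := fun l => (((l : ℕ) + 1 : ℝ) : ℂ)
  let A := Matrix.vandermonde v
  have hv : Function.Injective v := by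
    intro l l' h
    have h' : ((l : ℕ) : ℝ) + 1 = ((l' : ℕ) : ℝ) + 1 := Complex.ofReal_injective h
    exact Fin.ext (by exact_mod_cast add_right_cancel h')
  have hA : A⁻¹ * A = 1 :=
    Matrix.nonsing_inv_mul A (isUnit_iff_ne_zero.2 (Matrix.det_vandermonde_ne_zero_iff.2 hv))
  refine ⟨Fin 3 → Fin (M + 1), inferInstance,
    fun l => WithLp.toLp 2 fun a => ((l a : ℕ) + 1 : ℝ),
    fun l => ∏ a, A⁻¹ ⟨j a, hle hj a⟩ (l a), fun l h => ?_, fun j' hj' => ?_⟩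
  · have h0 : ((l 0 : ℕ) + 1 : ℝ) = 0 := congrArg (fun y : E3 => y 0) h
    exact absurd h0 (by positivity)
  · have h1 : ∀ l : Fin 3 → Fin (M + 1),
        (∏ a, A⁻¹ ⟨j a, hle hj a⟩ (l a)) * monom j' (WithLp.toLp 2 fun a => ((l a : ℕ) + 1 : ℝ))
        = ∏ a, A⁻¹ ⟨j a, hle hj a⟩ (l a) * A (l a) ⟨j' a, hle hj' a⟩ := by
      intro l
      rw [monom, ← Finset.prod_mul_distrib]
      rfl
    have h2 : ∀ a, ∑ m, A⁻¹ ⟨j a, hle hj a⟩ m * A m ⟨j' a, hle hj' a⟩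
        = if j' a = j a then 1 else 0 := by
      intro a
      have := congrFun (congrFun hA ⟨j a, hle hj a⟩) ⟨j' a, hle hj' a⟩
      rw [Matrix.mul_apply] at this
      rw [this, Matrix.one_apply]
      simp [Fin.ext_iff, eq_comm]
    rw [Finset.sum_congr rfl fun l _ => h1 l]
    have h3 := Finset.prod_univ_sum (fun _ : Fin 3 => (Finset.univ : Finset (Fin (M + 1))))
      (fun a m => A⁻¹ ⟨j a, hle hj a⟩ m * A m ⟨j' a, hle hj' a⟩)
    rw [Fintype.piFinset_univ] at h3
    rw [← h3, Finset.prod_congr rfl fun a _ => h2 a]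
    by_cases h : j' = j
    · simp [h]
    · rw [if_neg h]
      obtain ⟨a, ha⟩ := Function.ne_iff.1 h
      exact Finset.prod_eq_zero (Finset.mem_univ a) (if_neg ha)

theorem norm_le_norm_rotL (k : K) (x : E3) : ‖x‖ ≤ ‖rotL k x‖ := by
  rw [rotL_apply, norm_rot]

theorem isSchwartz_taylorQ_coeff {g : SpacePrime → ℂ} (hg : IsSchwartz g) (M : ℕ) :
    IsSchwartz fun x : E3 => (1 / (M.factorial : ℂ)) * (dt^[M] g) (x, 0) :=
  (hg.iterate_dt M).slice.const_mul _

theorem stripDecay_taylorQ {g : SpacePrime → ℂ} (hg : IsSchwartz g) (M : ℕ) :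
    StripDecay (taylorQ M g) := by
  rw [funext (taylorQ_eq hg.contDiff M)]
  exact IsSchwartz.stripDecay_mul (a := fun x => (1 / (M.factorial : ℂ)) * (dt^[M] g) (x, 0))
    (q := fun t : ℝ => (t : ℂ) ^ M) (isSchwartz_taylorQ_coeff hg M) (contDiff_ofReal_pow M)

theorem stripDecay_remainder {g : SpacePrime → ℂ} (hg : IsSchwartz g) (M : ℕ) :
    StripDecay (remainder M g) :=
  hg.stripDecay.sub (StripDecay.sum (fun m _ => stripDecay_taylorQ hg m)
    fun m _ => contDiff_taylorQ hg.contDiff m) hg.contDiff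
    (ContDiff.sum fun m _ => contDiff_taylorQ hg.contDiff m)

/-- For fixed y = k(0, 0, t) ≠ 0, P(·, y) is t^M times the Schwartz coefficient of Q_M composed with
a rotation. Each coefficient of P is a finite combination of such slices, hence Schwartz. -/
theorem stripDecay_of_eq_radial {g : SpacePrime → ℂ} (hg : g ∈ smoothInvPrime)
    (hgs : IsSchwartz g) {M : ℕ} {P : Space → ℂ} (hhom : IsHomogeneousInY M P)
    (hP : ∀ p ∈ regularPart, P p = radial (taylorQ M g) p) : StripDecay P := by
  obtain ⟨c, -, hc⟩ := hhom
  have hslice : ∀ y : E3, y ≠ 0 → IsSchwartz fun x => P (x, y) := by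
    intro y hy
    obtain ⟨k, t, hk⟩ := exists_rot_vert y
    have h1 := ((isSchwartz_taylorQ_coeff hgs M).comp_clm (rotL k⁻¹)
      (norm_le_norm_rotL k⁻¹)).const_mul ((t : ℂ) ^ M)
    have e : (fun x => P (x, y)) = fun x => (t : ℂ) ^ M *
        ((1 / (M.factorial : ℂ)) * (dt^[M] g) (rotL k⁻¹ x, 0)) := by
      funext x
      rw [hP _ hy, radial_eq (taylorQ_mem hg M).2 x y hy k t hk, taylorQ_eq hg.1, mul_comm,
        rotL_apply]
    rw [e]
    exact h1
  have hcoeff : ∀ j ∈ multiIndices M, IsSchwartz (c j) := by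
    intro j hj
    obtain ⟨ι, _, y, b, hy, hb⟩ := exists_interpolation M j hj
    have h1 : IsSchwartz fun x => ∑ l, b l * P (x, y l) :=
      IsSchwartz.sum fun l _ => (hslice _ (hy l)).const_mul (b l)
    have e : c j = fun x => ∑ l, b l * P (x, y l) := by
      funext x
      simp only [hc, Finset.mul_sum]
      rw [Finset.sum_comm]
      have h2 : ∀ j' ∈ multiIndices M, ∑ l, b l * (c j' x * monom j' (y l))
          = if j' = j then c j' x else 0 := by
        intro j' hj'
        rw [Finset.sum_congr rfl fun l _ => mul_left_comm (b l) (c j' x) (monom j' (y l)),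
          ← Finset.mul_sum, hb j' hj']
        simp
      rw [Finset.sum_congr rfl h2, Finset.sum_ite_eq', if_pos hj]
    rw [e]
    exact h1
  have h : P = fun p => ∑ j ∈ multiIndices M, c j p.1 * monom j p.2 := funext fun p => hc p.1 p.2
  rw [h]
  exact StripDecay.sum (fun j hj => (hcoeff j hj).stripDecay_mul (contDiff_monom j))
    fun j hj => ((hcoeff j hj).contDiff.comp contDiff_fst).mul ((contDiff_monom j).comp contDiff_snd)

theorem exists_bound_radial_of_one_le {g : SpacePrime → ℂ} (hg : g ∈ smoothInvPrime)
    (hgs : IsSchwartz g) (k n : ℕ) : ∃ C : ℝ, ∀ p : Space, 1 ≤ ‖p.2‖ →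
      ‖p‖ ^ k * ‖iteratedFDeriv ℝ n (radial g) p‖ ≤ C := by
  obtain ⟨B, hB0, hB⟩ := norm_iteratedFDeriv_radial_le n
  obtain ⟨C, hC⟩ := hgs.exists_bound (k + n) n
  -- As |y|⁻¹ ≤ 1, the loss is at most (4(1 + N))^n with N = |(x, y)|; decay of order k + n for g
  -- absorbs it.
  refine ⟨C * B * 4 ^ n, fun p hp => ?_⟩
  obtain ⟨x, y⟩ := p
  simp only at hp
  have hy : y ≠ 0 := norm_pos_iff.1 (by linarith)
  obtain ⟨x', hx', hmain⟩ := hB x y hy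
  obtain ⟨N, hN⟩ : ∃ N, N = ‖(x, y)‖ := ⟨_, rfl⟩
  have hN' : ‖(x', ‖y‖)‖ = N := by
    rw [hN, Prod.norm_def, Prod.norm_def, hx', norm_norm]
  have hxN : ‖x‖ ≤ N := hN ▸ norm_fst_le (x, y)
  have hyN : ‖y‖ ≤ N := hN ▸ norm_snd_le (x, y)
  have hN0 : 0 ≤ N := (norm_nonneg x).trans hxN
  have hC0 : 0 ≤ C := le_trans (by positivity) (hC 0 (Nat.zero_le _) 0)
  have h1 := hmain g hg (C / (1 + N) ^ (k + n)) fun i hi => by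
    rw [le_div_iff₀ (by positivity), mul_comm, ← hN']
    exact hC i hi _
  have h2 : (1 + ‖x‖ + ‖y‖) * (1 + ‖y‖⁻¹) ≤ 4 * (1 + N) := by
    have e : ‖y‖⁻¹ ≤ 1 := inv_le_one_of_one_le₀ hp
    calc _ ≤ (2 * (1 + N)) * 2 := by
          gcongr
          · linarith
          · linarith
      _ = _ := by ring
  rw [← hN]
  calc N ^ k * ‖iteratedFDeriv ℝ n (radial g) (x, y)‖
      ≤ (1 + N) ^ k * (C / (1 + N) ^ (k + n) * B * (4 * (1 + N)) ^ n) := by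
        refine mul_le_mul (pow_le_pow_left₀ hN0 (by linarith) k) (h1.trans ?_) (norm_nonneg _)
          (by positivity)
        gcongr
    _ = C * B * 4 ^ n := by
        have : (1 + N) ≠ 0 := by positivity
        rw [mul_pow, pow_add]
        field_simp

theorem exists_bound_radial_remainder {g : SpacePrime → ℂ} (hg : g ∈ smoothInvPrime)
    (hgs : IsSchwartz g) (k n : ℕ) : ∃ C : ℝ, ∀ x y : E3, y ≠ 0 → ‖y‖ ≤ 1 →
      (1 + ‖x‖) ^ k * ‖iteratedFDeriv ℝ n (radial (remainder (2 * n + 1) g)) (x, y)‖ ≤ C := by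
  obtain ⟨B, hB0, hB⟩ := norm_iteratedFDeriv_radial_le_of_flat n
  -- The additional n powers of decay compensate the factor (1 + |x|)^n of the flat estimate.
  obtain ⟨C, hC⟩ := stripDecay_remainder hgs (2 * n + 1) (k + n) (2 * n + 1)
  have hC0 : 0 ≤ C := le_trans (by positivity) (hC 0 0 (by simp))
  refine ⟨C * B, fun x y hy hy1 => ?_⟩
  have h1 := hB _ (remainder_mem hg (2 * n + 1)) (2 * n + 1) (by omega)
    (iterate_dt_remainder hg _) x y (C / (1 + ‖x‖) ^ (k + n)) hy hy1 fun x' s hx' hs => by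
      rw [le_div_iff₀ (by positivity), mul_comm, ← hx']
      exact hC x' s hs
  calc _ ≤ (1 + ‖x‖) ^ k * (C / (1 + ‖x‖) ^ (k + n) * B * (1 + ‖x‖) ^ n * 1) := by
        gcongr
        refine h1.trans ?_
        gcongr
        exact pow_le_one₀ (norm_nonneg y) hy1
    _ = C * B := by
        have : (1 + ‖x‖) ≠ 0 := by positivity
        rw [pow_add]
        field_simp

theorem isSchwartz_extension {g : SpacePrime → ℂ} (hg : g ∈ smoothInvPrime) (hgs : IsSchwartz g)
    {P : ℕ → Space → ℂ} (hP : ∀ M, ContDiff ℝ ∞ (P M)) (hhom : ∀ M, IsHomogeneousInY M (P M))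
    (hPr : ∀ M, ∀ p ∈ regularPart, P M p = radial (taylorQ M g) p) :
    IsSchwartz (extension g) := by
  have hsm := contDiff_extension hg hP hhom hPr
  refine ⟨⟨extension g, hsm, fun k n => ?_⟩, rfl⟩
  obtain ⟨C₁, h₁⟩ := exists_bound_radial_of_one_le hg hgs k n
  obtain ⟨C₂, h₂⟩ := exists_bound_radial_remainder hg hgs k n
  -- Order 2n would suffice for flatness; 2n + 1 is also nonzero when n = 0, as
  -- `extension_eq_sum_add` requires.
  obtain ⟨C₃, h₃⟩ := StripDecay.sum (s := Finset.range (2 * n + 1)) (f := P)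
    (fun m _ => stripDecay_of_eq_radial hg hgs (hhom m) (hPr m)) (fun m _ => hP m) k n
  have hopen : IsOpen regularPart := isOpen_ne_fun continuous_snd continuous_const
  have hreg : ∀ p ∈ regularPart,
      ‖p‖ ^ k * ‖iteratedFDeriv ℝ n (extension g) p‖ ≤ max C₁ (C₃ + C₂) := by
    rintro ⟨x, y⟩ hy
    change y ≠ 0 at hy
    rcases le_total 1 ‖y‖ with hy1 | hy1
    · have he : extension g =ᶠ[nhds (x, y)] radial g := by
        filter_upwards [hopen.mem_nhds hy] with q hq
        exact extension_eq_radial g hq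
      rw [(he.iteratedFDeriv ℝ n).eq_of_nhds]
      exact (h₁ (x, y) hy1).trans (le_max_left _ _)
    · have he : extension g =ᶠ[nhds (x, y)]
          (fun p => ∑ m ∈ Finset.range (2 * n + 1), P m p) + radial (remainder (2 * n + 1) g) := by
        filter_upwards [hopen.mem_nhds hy] with q hq
        rw [extension_eq_sum_add hg hhom hPr (M := 2 * n + 1) (by omega) q, if_neg hq]
        rfl
      rw [(he.iteratedFDeriv ℝ n).eq_of_nhds, iteratedFDeriv_add_apply
        ((ContDiff.sum fun m _ => hP m).of_le (WithTop.coe_le_coe.2 le_top)).contDiffAt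
        ((contDiffAt_radial (remainder_mem hg _) hy).of_le (WithTop.coe_le_coe.2 le_top))]
      have hN : ‖(x, y)‖ ≤ 1 + ‖x‖ := by
        rw [Prod.norm_def]
        exact max_le (by simp) (hy1.trans (by simp))
      calc _ ≤ (1 + ‖x‖) ^ k * (‖iteratedFDeriv ℝ n
              (fun p => ∑ m ∈ Finset.range (2 * n + 1), P m p) (x, y)‖
              + ‖iteratedFDeriv ℝ n (radial (remainder (2 * n + 1) g)) (x, y)‖) := by
            gcongr
            exact norm_add_le _ _
        _ ≤ C₃ + C₂ := by
            rw [mul_add]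
            exact add_le_add (h₃ x y hy1) (h₂ x y hy hy1)
        _ ≤ _ := le_max_right _ _
  refine ⟨max C₁ (C₃ + C₂), fun p => ?_⟩
  -- The bound is a closed condition, so it passes from the dense set y ≠ 0 to all points.
  have hclosed : IsClosed {p : Space |
      ‖p‖ ^ k * ‖iteratedFDeriv ℝ n (extension g) p‖ ≤ max C₁ (C₃ + C₂)} :=
    isClosed_le ((continuous_norm.pow k).mul
      (hsm.continuous_iteratedFDeriv (m := n) (WithTop.coe_le_coe.2 le_top)).norm) continuous_const
  exact hclosed.closure_subset_iff.2 hreg (dense_regularPart p)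

end RadialExtension

theorem proposition8 (g : RadialExtension.SpacePrime → ℂ)
    (hg : g ∈ RadialExtension.smoothInvPrime) :
    (g ∈ RadialExtension.rest '' RadialExtension.smoothInv ↔ RadialExtension.PropertyR g) ∧
    (RadialExtension.PropertyR g →
      ∃ f ∈ RadialExtension.smoothInv,
        (∀ p ∈ RadialExtension.regularPart, f p = RadialExtension.radial g p) ∧
        RadialExtension.rest f = g ∧
        (∀ M : ℕ, RadialExtension.taylorQ M g =
          RadialExtension.rest (RadialExtension.taylorP M f)) ∧
        (RadialExtension.IsSchwartz g → RadialExtension.IsSchwartz f)) := by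
  have key : RadialExtension.PropertyR g →
      ∃ f ∈ RadialExtension.smoothInv,
        (∀ p ∈ RadialExtension.regularPart, f p = RadialExtension.radial g p) ∧
        RadialExtension.rest f = g ∧
        (∀ M : ℕ, RadialExtension.taylorQ M g =
          RadialExtension.rest (RadialExtension.taylorP M f)) ∧
        (RadialExtension.IsSchwartz g → RadialExtension.IsSchwartz f) := by
    intro hR
    choose P hP hhom hPr using hR
    have hsm := RadialExtension.contDiff_extension hg hP hhom hPr
    have hrest := RadialExtension.rest_extension hg
    refine ⟨RadialExtension.extension g,
      ⟨hsm, RadialExtension.extension_act hg hsm.continuous⟩,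
      fun p hp => RadialExtension.extension_eq_radial g hp, hrest, fun M => ?_,
      fun hgs => RadialExtension.isSchwartz_extension hg hgs hP hhom hPr⟩
    rw [← RadialExtension.taylorQ_rest hsm M, hrest]
  refine ⟨⟨?_, fun hR => ?_⟩, key⟩
  · rintro ⟨f, hf, rfl⟩
    exact RadialExtension.propertyR_rest hf hg
  · obtain ⟨f, hf, -, hrest, -⟩ := key hR
    exact ⟨f, hf, hrest⟩
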